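/- All graphs are finite, simple and considered up to isomorphism. For $r\ge 2$ and $n,m\in\mathbb N$, the \emph{$r$-biweb} $W^r_{n,m}$ is the graph obtained from the complete bipartite graph $K_{n,m}$ by replacing every edge by a path of length $r+1$ and then turning the neighborhood of every native vertex (that is, every original vertex of $K_{n,m}$) into a clique. A \emph{$k$-flip} of a graph $G$ is any graph $G'$ on $V(G)$ for which there are a coloring $\lambda\colon V(G)\to\{1,\dots,k\}$ and a symmetric relation $R\subseteq\{1,\dots,k\}^2$ such that for all distinct $u,v$: $uv\in E(G')$ if and only if exactly one of $uv\in E(G)$ and $(\lambda(u),\lambda(v))\in R$ holds. A class of graphs is \emph{hereditary} if it is closed under taking induced subgraphs. A first-order formula in the language of graphs is \emph{existential} if it contains no universal quantifiers and negation is applied only to quantifier-free subformulas. \textbf{Theorem.} Let $r\ge 3$ and $k\in\mathbb N$, and let $\mathscr C$ be a hereditary class of graphs that contains a $k$-flip of every $r$-biweb $W^r_{n,m}$. Then $\mathscr C$ effectively interprets the class of all graphs using existential formulas on singletons. That is, there are existential first-order formulas $\delta(x)$ and $\varphi(x,y)$ in the language of graphs, where $x,y$ are single variables and $\varphi$ is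 symmetric and irreflexive on all graphs, and an algorithm which, given an arbitrary graph $H$, computes in time polynomial in $|V(H)|$ a graph $G\in\mathscr C$ whose number of vertices is polynomial in $|V(H)|$, such that $H$ is isomorphic to the graph $I_{\delta,\varphi}(G)$ with vertex set $\{v\in V(G): G\models\delta(v)\}$ and edge set consisting of all pairs $uv$ of distinct vertices of this set with $G\models\varphi(u,v)$. -/

import Mathlib

open FirstOrder

/-! ### Graph classes, biwebs and flips -/

/-- A class of finite simple graphs. -/
def GraphClass : Type 1 := ∀ (V : Type) [Finite V], SimpleGraph V → Prop

/-- `C` is closed under taking induced subgraphs, where (as always for graph classes) graphs are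
considered up to isomorphism: `H` is isomorphic to an induced subgraph of `G` iff there is a graph
embedding `H ↪g G`. -/
def GraphClass.Hereditary (C : GraphClass) : Prop :=
  ∀ (V W : Type) [Finite V] [Finite W] (G : SimpleGraph V) (H : SimpleGraph W),
    C V G → Nonempty (H ↪g G) → C W H

/-- The class of all (finite, simple) graphs. -/
def allGraphs : GraphClass := fun _ _ _ => True

/-- Vertices of the `r`-subdivision of `K_{n,m}`: the native vertices of the two sides, and for
every edge `(i, j)` of `K_{n,m}` the `r` inner vertices `(i, j, 0), …, (i, j, r - 1)` of the path
replacing that edge, in the order in which the path runs from `i` to `j`. -/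
abbrev BiwebVertex (r n m : ℕ) : Type := (Fin n ⊕ Fin m) ⊕ (Fin n × Fin m × Fin r)

/-- The `r`-subdivision of the complete bipartite graph `K_{n,m}`: every edge is replaced by a path
of length `r + 1`. -/
def subdividedBiclique (r n m : ℕ) : SimpleGraph (BiwebVertex r n m) :=
  SimpleGraph.fromRel fun x y =>
    match x, y with
    | .inl (.inl _), .inl (.inr _) => r = 0
    | .inl (.inl i), .inr (i', _, p) => i = i' ∧ p.val = 0
    | .inr (_, j, p), .inl (.inr j') => j = j' ∧ p.val + 1 = r
    | .inr (i, j, p), .inr (i', j', p') => i = i' ∧ j = j' ∧ p.val + 1 = p'.val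
    | _, _ => False

/-- The `r`-biweb `W^r_{n,m}` of order `(n, m)`: the `r`-subdivision of `K_{n,m}` in which the
neighborhood of every native vertex is turned into a clique. -/
def biweb (r n m : ℕ) : SimpleGraph (BiwebVertex r n m) :=
  SimpleGraph.fromRel fun x y =>
    (subdividedBiclique r n m).Adj x y ∨
      ∃ w : Fin n ⊕ Fin m,
        (subdividedBiclique r n m).Adj (.inl w) x ∧ (subdividedBiclique r n m).Adj (.inl w) y

/-- `G'` is a `k`-flip of `G`: for some coloring of the vertices with `k` colors and some symmetric
relation `R` on the colors, `G'` arises from `G` by complementing the adjacency between all pairs of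
distinct vertices whose colors are related by `R`. -/
def IsFlip {V : Type} (k : ℕ) (G G' : SimpleGraph V) : Prop :=
  ∃ (col : V → Fin k) (R : Fin k → Fin k → Prop), (∀ a b, R a b → R b a) ∧
    ∀ u v, u ≠ v → (G'.Adj u v ↔ Xor (G.Adj u v) (R (col u) (col v)))

/-! ### First-order formulas and interpretations -/

/-- Existential formulas: those built from quantifier-free formulas by conjunction, disjunction and
existential quantification, i.e. without universal quantifiers and with negation applied only to
quantifier-free subformulas. -/
inductive IsExistentialFormula {L : Language} {α : Type} :
    ∀ {n : ℕ}, L.BoundedFormula α n → Prop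
  | of_isQF {n : ℕ} {φ : L.BoundedFormula α n} : φ.IsQF → IsExistentialFormula φ
  | and {n : ℕ} {φ ψ : L.BoundedFormula α n} :
      IsExistentialFormula φ → IsExistentialFormula ψ → IsExistentialFormula (φ ⊓ ψ)
  | or {n : ℕ} {φ ψ : L.BoundedFormula α n} :
      IsExistentialFormula φ → IsExistentialFormula ψ → IsExistentialFormula (φ ⊔ ψ)
  | ex {n : ℕ} {φ : L.BoundedFormula α (n + 1)} :
      IsExistentialFormula φ → IsExistentialFormula φ.ex

/-- `G ⊨ φ(v)` for a first-order formula in the language of graphs. -/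
def Sat {V α : Type} (G : SimpleGraph V) (φ : Language.graph.Formula α) (v : α → V) : Prop :=
  @Language.Formula.Realize Language.graph V G.structure α φ v

/-- A (1-dimensional) interpretation of graphs in graphs: a domain formula `δ(x)` and an edge
formula `φ(x, y)` that is symmetric and irreflexive on all finite graphs. -/
structure Interpretation where
  dom : Language.graph.Formula (Fin 1)
  edge : Language.graph.Formula (Fin 2)
  edge_irrefl : ∀ (V : Type) [Finite V] (G : SimpleGraph V) (u : V), ¬ Sat G edge ![u, u]
  edge_symm : ∀ (V : Type) [Finite V] (G : SimpleGraph V) (u v : V),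
    Sat G edge ![u, v] → Sat G edge ![v, u]

/-- The graph `I(G)`, on the vertex set `{v | G ⊨ δ(v)}`. -/
def Interpretation.apply (I : Interpretation) {V : Type} [Finite V] (G : SimpleGraph V) :
    SimpleGraph {v : V // Sat G I.dom ![v]} where
  Adj u v := Sat G I.edge ![u.val, v.val]
  symm := ⟨fun u v h => I.edge_symm V G u.val v.val h⟩
  loopless := ⟨fun u h => I.edge_irrefl V G u.val h⟩

/-- Both formulas of the interpretation are existential. -/
def Interpretation.Existential (I : Interpretation) : Prop :=
  IsExistentialFormula I.dom ∧ IsExistentialFormula I.edge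

/-! ### Algorithms: a random access machine with unit costs -/

namespace RAM

/-- Programs of the machine. It has registers `x₀, x₁, …` and arrays `A₀, A₁, …`, all holding
natural numbers. The only arithmetic is addition and truncated subtraction, so that the bit lengths
of the numbers that occur grow by at most one per step and unit costs are polynomially equivalent
to the costs of a Turing machine. -/
inductive Prog : Type
  /-- `x := c` -/
  | const (x c : ℕ) : Prog
  /-- `x := y + z` -/
  | add (x y z : ℕ) : Prog
  /-- `x := y - z` (truncated) -/
  | sub (x y z : ℕ) : Prog
  /-- `x := A[i]` -/
  | read (x A i : ℕ) : Prog
  /-- `A[i] := x` -/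
  | write (A i x : ℕ) : Prog
  /-- `P; Q` -/
  | seq (P Q : Prog) : Prog
  /-- `if x ≠ 0 then P else Q` -/
  | ite (x : ℕ) (P Q : Prog) : Prog
  /-- `while x ≠ 0 do P` -/
  | loop (x : ℕ) (P : Prog) : Prog

/-- The contents of the registers and of the arrays. -/
structure State : Type where
  reg : ℕ → ℕ
  arr : ℕ → ℕ → ℕ

/-- Assign the value `a` to register `x`. -/
def State.setReg (s : State) (x a : ℕ) : State :=
  ⟨Function.update s.reg x a, s.arr⟩

/-- Assign the value `a` to the cell with index `i` of the array `A`. -/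
def State.setArr (s : State) (A i a : ℕ) : State :=
  ⟨s.reg, Function.update s.arr A (Function.update (s.arr A) i a)⟩

/-- `Run P s t s'`: the program `P`, started in state `s`, halts in state `s'` after exactly `t`
steps. Every assignment and every test costs one step. -/
inductive Run : Prog → State → ℕ → State → Prop
  | const (s : State) (x c : ℕ) : Run (.const x c) s 1 (s.setReg x c)
  | add (s : State) (x y z : ℕ) : Run (.add x y z) s 1 (s.setReg x (s.reg y + s.reg z))
  | sub (s : State) (x y z : ℕ) : Run (.sub x y z) s 1 (s.setReg x (s.reg y - s.reg z))
  | read (s : State) (x A i : ℕ) : Run (.read x A i) s 1 (s.setReg x (s.arr A (s.reg i)))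
  | write (s : State) (A i x : ℕ) : Run (.write A i x) s 1 (s.setArr A (s.reg i) (s.reg x))
  | seq {P Q : Prog} {s s₁ s₂ : State} {t₁ t₂ : ℕ} :
      Run P s t₁ s₁ → Run Q s₁ t₂ s₂ → Run (.seq P Q) s (t₁ + t₂) s₂
  | ite_true {x : ℕ} {P Q : Prog} {s s₁ : State} {t : ℕ} :
      s.reg x ≠ 0 → Run P s t s₁ → Run (.ite x P Q) s (t + 1) s₁
  | ite_false {x : ℕ} {P Q : Prog} {s s₁ : State} {t : ℕ} :
      s.reg x = 0 → Run Q s t s₁ → Run (.ite x P Q) s (t + 1) s₁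
  | loop_stop {x : ℕ} {P : Prog} {s : State} :
      s.reg x = 0 → Run (.loop x P) s 1 s
  | loop_step {x : ℕ} {P : Prog} {s s₁ s₂ : State} {t₁ t₂ : ℕ} :
      s.reg x ≠ 0 → Run P s t₁ s₁ → Run (.loop x P) s₁ t₂ s₂ →
      Run (.loop x P) s (t₁ + t₂ + 1) s₂

open Classical in
/-- The adjacency matrix of a graph on `{0, …, n - 1}`, row by row in one array (and zero beyond
the `n * n` entries of the matrix). -/
noncomputable def adjArray {n : ℕ} (G : SimpleGraph (Fin n)) (a : ℕ) : ℕ :=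
  if ∃ u v : Fin n, G.Adj u v ∧ a = n * u.val + v.val then 1 else 0

/-- The initial state on the input graph `G`: the number of vertices is in register `0`, the
adjacency matrix is in array `0`, and everything else is zero. -/
noncomputable def input {n : ℕ} (G : SimpleGraph (Fin n)) : State where
  reg x := if x = 0 then n else 0
  arr A a := if A = 0 then adjArray G a else 0

/-- The state `s` holds the output graph `G`: the number of vertices is in register `1`, and the
adjacency matrix is in array `1`. -/
def Outputs {n : ℕ} (s : State) (G : SimpleGraph (Fin n)) : Prop :=
  s.reg 1 = n ∧ ∀ a < n * n, s.arr 1 a = adjArray G a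

end RAM

/-! ### Effective interpretations -/

/-- `C` effectively interprets `D` by means of `I`: there is an algorithm that, given a graph `H` in
`D`, computes in polynomial time a graph `G` in `C` of polynomial size with `I(G)` isomorphic to
`H`. -/
def EffectivelyInterpretsBy (I : Interpretation) (C D : GraphClass) : Prop :=
  ∃ (P : RAM.Prog) (time size : Polynomial ℕ),
    ∀ (n : ℕ) (H : SimpleGraph (Fin n)), D (Fin n) H →
      ∃ (N : ℕ) (G : SimpleGraph (Fin N)), C (Fin N) G ∧ N ≤ size.eval n ∧
        Nonempty (I.apply G ≃g H) ∧
        ∃ (t : ℕ) (s : RAM.State), t ≤ time.eval n ∧ RAM.Run P (RAM.input H) t s ∧ RAM.Outputs s G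

/-- `C` effectively interprets `D` on singletons by an interpretation with existential domain
formula `δ(x)` and existential edge formula `φ(x, y)`. -/
def EffectivelyExistentiallyInterprets (C D : GraphClass) : Prop :=
  ∃ I : Interpretation, I.Existential ∧ EffectivelyInterpretsBy I C D

/-! ### Existential formulas describing induced copies of a fixed graph -/

namespace InducedCopy

open Language

/-! Only the inner vertices of a biweb are used. They form a block graph: each subdivided edge is a
path, or block, with `r` layers; first layers are joined when the left ends agree, last layers when
the right ends agree. Color each edge of the complete bipartite graph by the color vector of its
path. A bipartite Ramsey argument yields a large subgrid on which the flip depends only on the two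
layers involved, so it is given by a set `S` of unordered pairs of layers. There are finitely many
`S`, so one of them serves all sizes (`exists_forall_containsBlockGraphs`), and by heredity `C`
contains every finite block graph flipped by `S` whose blocks are distinct grid cells.

A graph `H` is encoded by giving each vertex `u` a large first-layer clique that contains a marker
block and one block for every `v`. The blocks `(u, v)` and `(v, u)` meet in the last layer exactly
when `uv` is an edge, and a last-layer triangle singles out the marker. Last-layer cliques have at
most three members, so a larger clique within one layer must be in the first layer; this
distinguishes the two ends of a block. The formulas ask for an induced copy of a fixed flipped
pattern with prescribed roots.

The danger is a copy sitting in the flipped graph in an unintended way. Each pattern therefore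
carries more than `3 * r ^ r` free blocks, paths isolated before flipping, so that four of them are
mapped with the same layer map `π`. By `mem_iff_of_four_paths`, `π` preserves `S`: a discrepancy
would force cliques, claws or collisions that the host and an injective map do not allow. Comparing
the other pattern vertices with these paths, `embedding_unflip` shows that the embedding respects
adjacency before flipping. There, blocks in large first-layer cliques go to blocks
(`exists_block_of_clique`), and `exists_dom_iff` and `exists_edge_iff` recover the vertices and
edges of `H`. As `r`, `S` and the number of free blocks are constants, a polynomial-time program
writes the encoding (`exists_program`). -/

theorem isQF_iInf {L : Language} {α β : Type} {n : ℕ} [Finite β] (f : β → L.BoundedFormula α n)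
    (h : ∀ b, (f b).IsQF) : (BoundedFormula.iInf f).IsQF := by
  have key : ∀ l : List (L.BoundedFormula α n), (∀ φ ∈ l, φ.IsQF) →
      (l.foldr (· ⊓ ·) ⊤).IsQF := by
    intro l
    induction l with
    | nil => intro _; exact BoundedFormula.IsQF.top
    | cons a l ih =>
      intro hl
      exact (hl a (by simp)).inf (ih fun φ hφ => hl φ (by simp [hφ]))
  apply key
  intro φ hφ
  simp only [List.mem_map] at hφ
  obtain ⟨b, -, rfl⟩ := hφ
  exact h b

theorem isExistentialFormula_exs {L : Language} {α : Type} :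
    ∀ {n : ℕ} (φ : L.BoundedFormula α n), IsExistentialFormula φ → IsExistentialFormula φ.exs
  | 0, _, h => h
  | _ + 1, φ, h => isExistentialFormula_exs φ.ex h.ex

theorem isExistentialFormula_iExs {L : Language} {α β : Type} [Finite β] (φ : L.Formula (α ⊕ β))
    (h : BoundedFormula.IsQF φ) : IsExistentialFormula (φ.iExs β) :=
  isExistentialFormula_exs _ (.of_isQF (h.relabel _))

/-- The literal stating adjacency or non-adjacency of two variables. -/
noncomputable def adjLiteral {α : Type} (p : Prop) (x y : α) : Language.graph.Formula α :=
  open Classical in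
  if p then adj.formula₂ (.var x) (.var y) else (adj.formula₂ (.var x) (.var y)).not

/-- The literal stating that two variables are equal, or that they are different. -/
noncomputable def eqLiteral {α : Type} (p : Prop) (x y : α) : Language.graph.Formula α :=
  open Classical in
  if p then (Term.var x).equal (.var y) else ((Term.var x).equal (.var y)).not

theorem isQF_adjLiteral {α : Type} (p : Prop) (x y : α) :
    BoundedFormula.IsQF (adjLiteral p x y) := by
  unfold adjLiteral
  split_ifs
  · exact .of_isAtomic (.rel _ _)
  · exact BoundedFormula.IsQF.not (.of_isAtomic (.rel _ _))

theorem isQF_eqLiteral {α : Type} (p : Prop) (x y : α) :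
    BoundedFormula.IsQF (eqLiteral p x y) := by
  unfold eqLiteral
  split_ifs
  · exact .of_isAtomic (.equal _ _)
  · exact BoundedFormula.IsQF.not (.of_isAtomic (.equal _ _))

theorem sat_adjLiteral {V α : Type} (G : SimpleGraph V) (p : Prop) (x y : α) (v : α → V) :
    Sat G (adjLiteral p x y) v ↔ (G.Adj (v x) (v y) ↔ p) := by
  let := G.structure
  have h : (adj.formula₂ (.var x) (.var y) : Language.graph.Formula α).Realize v ↔
      G.Adj (v x) (v y) := by
    rw [Formula.realize_rel₂]; rfl
  unfold Sat adjLiteral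
  split_ifs with hp
  · simp [h, hp]
  · simp [Formula.realize_not, h, hp]

theorem sat_eqLiteral {V α : Type} (G : SimpleGraph V) (p : Prop) (x y : α) (v : α → V) :
    Sat G (eqLiteral p x y) v ↔ (v x = v y ↔ p) := by
  let := G.structure
  unfold Sat eqLiteral
  split_ifs with hp
  · simp [hp]
  · simp [Formula.realize_not, hp]

/-- "Some induced copy of the finite graph `F` has given vertices as its roots" is expressed by an
existential formula. -/
theorem exists_formula {ι α : Type} [Finite ι] [Finite α] (F : SimpleGraph ι) (ρ : α → ι) :
    ∃ φ : Language.graph.Formula α, IsExistentialFormula φ ∧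
      ∀ (V : Type) (G : SimpleGraph V) (v : α → V),
        Sat G φ v ↔ ∃ f : F ↪g G, ∀ a, f (ρ a) = v a := by
  -- Variables `Sum.inr` name the copy and get quantified; `Sum.inl` are the roots. The conjuncts
  -- are the adjacencies, injectivity and the position of the roots.
  let ψ : Language.graph.Formula (α ⊕ ι) :=
    Formula.iInf (fun p : ι × ι => adjLiteral (F.Adj p.1 p.2) (Sum.inr p.1) (Sum.inr p.2)) ⊓
    (Formula.iInf (fun p : ι × ι => eqLiteral (p.1 = p.2) (Sum.inr p.1) (Sum.inr p.2)) ⊓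
     Formula.iInf (fun a : α => eqLiteral True (Sum.inr (ρ a)) (Sum.inl a)))
  have hψ : BoundedFormula.IsQF ψ :=
    (isQF_iInf _ fun _ => isQF_adjLiteral _ _ _).inf
      ((isQF_iInf _ fun _ => isQF_eqLiteral _ _ _).inf (isQF_iInf _ fun _ => isQF_eqLiteral _ _ _))
  refine ⟨ψ.iExs ι, isExistentialFormula_iExs ψ hψ, fun V G v => ?_⟩
  let := G.structure
  have h1 := fun (w : ι → V) (p : ι × ι) => sat_adjLiteral G (F.Adj p.1 p.2) (Sum.inr p.1)
    (Sum.inr p.2) (Sum.elim v w)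
  have h2 := fun (w : ι → V) (p : ι × ι) => sat_eqLiteral G (p.1 = p.2) (Sum.inr p.1)
    (Sum.inr p.2) (Sum.elim v w)
  have h3 := fun (w : ι → V) (a : α) => sat_eqLiteral G True (Sum.inr (ρ a))
    (Sum.inl a) (Sum.elim v w)
  unfold Sat at h1 h2 h3 ⊢
  simp only [ψ, Formula.realize_iExs, Formula.realize_inf, Formula.realize_iInf, h1, h2, h3,
    Sum.elim_inl, Sum.elim_inr, Prod.forall, iff_true]
  constructor
  · rintro ⟨w, ha, he, hr⟩
    exact ⟨⟨⟨w, fun a b hab => (he a b).1 hab⟩, fun {a b} => ha a b⟩, hr⟩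
  · rintro ⟨f, hf⟩
    exact ⟨f, fun a b => f.map_adj_iff, fun a b => f.injective.eq_iff, hf⟩

end InducedCopy

/-! ### Block graphs: disjoint paths glued along cliques at both ends, and their flips -/

/-- Adjacency in a block graph before flipping (for distinct vertices): the blocks are paths with
`r` layers; first layers of blocks are linked if the blocks have the same `I`-value, last layers are
linked if the blocks have the same `J`-value. -/
def BlockLink {r : ℕ} {B α β : Type} (I : B → α) (J : B → β) (u v : B × Fin r) : Prop :=
  (u.1 = v.1 ∧ (u.2.val + 1 = v.2.val ∨ v.2.val + 1 = u.2.val)) ∨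
  (u.2.val = 0 ∧ v.2.val = 0 ∧ I u.1 = I v.1) ∨
  (u.2.val + 1 = r ∧ v.2.val + 1 = r ∧ J u.1 = J v.1)

/-- The block graph given by `I` and `J`, flipped between the pairs of layers in `S`. -/
def blockGraph {r : ℕ} {B α β : Type} (S : Set (Sym2 (Fin r))) (I : B → α) (J : B → β) :
    SimpleGraph (B × Fin r) where
  Adj u v := u ≠ v ∧ Xor (BlockLink I J u v) (s(u.2, v.2) ∈ S)
  symm := ⟨by
    rintro u v ⟨h, h'⟩
    refine ⟨h.symm, ?_⟩
    have e : BlockLink I J v u ↔ BlockLink I J u v := by unfold BlockLink; grind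
    rwa [e, Sym2.eq_swap]⟩
  loopless := ⟨fun _ h => h.1 rfl⟩

namespace BlockGraph

variable {r : ℕ} {B B' α β α' β' : Type} {I : B → α} {J : B → β} {I' : B' → α'} {J' : B' → β'}

theorem adj_iff {S : Set (Sym2 (Fin r))} {u v : B × Fin r} :
    (blockGraph S I J).Adj u v ↔ u ≠ v ∧ Xor (BlockLink I J u v) (s(u.2, v.2) ∈ S) := Iff.rfl

theorem adj_empty_iff {u v : B × Fin r} :
    (blockGraph ∅ I J).Adj u v ↔ u ≠ v ∧ BlockLink I J u v := by
  simp [adj_iff, Xor]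

theorem adj_iff_xor {S : Set (Sym2 (Fin r))} {u v : B × Fin r} (h : u ≠ v) :
    (blockGraph S I J).Adj u v ↔ Xor ((blockGraph ∅ I J).Adj u v) (s(u.2, v.2) ∈ S) := by
  rw [adj_iff, adj_empty_iff]
  simp only [h, ne_eq, not_false_eq_true, true_and]

/-- A map of blocks preserving the equality patterns of `I` and `J` induces an embedding. -/
def embedding (S : Set (Sym2 (Fin r))) (κ : B' → B) (hκ : Function.Injective κ)
    (hI : ∀ b c, I (κ b) = I (κ c) ↔ I' b = I' c) (hJ : ∀ b c, J (κ b) = J (κ c) ↔ J' b = J' c) :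
    blockGraph S I' J' ↪g blockGraph S I J where
  toFun u := (κ u.1, u.2)
  inj' := by
    rintro ⟨b, l⟩ ⟨c, m⟩ h
    simp only [Prod.mk.injEq] at h
    simp [hκ h.1, h.2]
  map_rel_iff' := by
    rintro ⟨b, l⟩ ⟨c, m⟩
    change (blockGraph S I J).Adj (κ b, l) (κ c, m) ↔ _
    simp only [adj_iff, BlockLink, hI, hJ, hκ.eq_iff, ne_eq, Prod.mk.injEq]

/-- Three neighbors of a vertex in the same layer are not independent. -/
theorem not_claw (hr : 3 ≤ r) {v a b c : B × Fin r} (hab : a ≠ b) (hac : a ≠ c) (hbc : b ≠ c)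
    (lab : a.2 = b.2) (lac : a.2 = c.2) (va : (blockGraph ∅ I J).Adj v a)
    (vb : (blockGraph ∅ I J).Adj v b) (vc : (blockGraph ∅ I J).Adj v c)
    (nab : ¬ (blockGraph ∅ I J).Adj a b) (nac : ¬ (blockGraph ∅ I J).Adj a c)
    (nbc : ¬ (blockGraph ∅ I J).Adj b c) : False := by
  simp only [adj_empty_iff, BlockLink] at *
  obtain ⟨v, lv⟩ := v
  obtain ⟨a, la⟩ := a
  obtain ⟨b, lb⟩ := b
  obtain ⟨c, lc⟩ := c
  obtain rfl : la = lb := lab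
  obtain rfl : la = lc := lac
  simp only [ne_eq, Prod.mk.injEq, and_true] at *
  obtain ⟨-, va | va | va⟩ := va <;> obtain ⟨-, vb | vb | vb⟩ := vb <;>
    obtain ⟨-, vc | vc | vc⟩ := vc <;> grind

/-- The vertices of a triangle lie in the same layer. -/
theorem layer_eq_of_triangle (hr : 3 ≤ r) {u v w : B × Fin r} (uv : (blockGraph ∅ I J).Adj u v)
    (uw : (blockGraph ∅ I J).Adj u w) (vw : (blockGraph ∅ I J).Adj v w) : u.2 = v.2 := by
  simp only [adj_empty_iff, BlockLink] at *
  obtain ⟨u, lu, _⟩ := u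
  obtain ⟨v, lv, _⟩ := v
  obtain ⟨w, lw, _⟩ := w
  simp only [ne_eq, Prod.mk.injEq, Fin.mk.injEq, not_and] at *
  grind

/-- A walk without repetitions that enters a block from its first layer runs through the block. -/
theorem walk_eq (w : ℕ → B × Fin r) (b : B)
    (hinj : ∀ i j, i < r → j < r → w i = w j → i = j)
    (hadj : ∀ i, i + 1 < r → (blockGraph ∅ I J).Adj (w i) (w (i + 1)))
    (h0 : ∀ h : 0 < r, w 0 = (b, ⟨0, h⟩)) (h1 : ∀ h : 1 < r, w 1 = (b, ⟨1, h⟩)) :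
    ∀ i (h : i < r), w i = (b, ⟨i, h⟩) := by
  intro i
  induction i using Nat.strong_induction_on with
  | _ i ih =>
    intro h
    match i, h, ih with
    | 0, h, _ => exact h0 h
    | 1, h, _ => exact h1 h
    | i + 2, h, ih =>
      have e0 := ih i (by omega) (by omega)
      have e1 := ih (i + 1) (by omega) (by omega)
      have ha := hadj (i + 1) h
      have hne : w (i + 2) ≠ w i := fun e => by
        have := hinj _ _ h (by omega) e
        omega
      rw [e1] at ha
      rw [e0] at hne
      change (blockGraph ∅ I J).Adj _ (w (i + 2)) at ha
      generalize w (i + 2) = x at ha hne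
      obtain ⟨x, l, hl⟩ := x
      simp only [adj_empty_iff, BlockLink] at ha
      simp only [ne_eq, Prod.mk.injEq, Fin.mk.injEq, not_and] at *
      grind

end BlockGraph

/-! ### Comparing the flip inside and outside an embedded pattern -/

namespace BlockGraph

variable {r : ℕ} {B B' α β α' β' : Type} {I : B → α} {J : B → β} {I' : B' → α'} {J' : B' → β'}

/-- Up to equality of rows of `S`, `π` is invertible: it preserves `S` and its iterates repeat, so
some `π^[p + 1]` changes no row and `π^[p]` acts as an inverse. Thus `a` has the row of `π^[p] m`
and `b` that of `π^[p] m'`, and `π^[p]` preserves `S`. -/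
theorem mem_iff_of_layer_map {S : Set (Sym2 (Fin r))} {π : Fin r → Fin r}
    (h : ∀ l m, s(l, m) ∈ S ↔ s(π l, π m) ∈ S) {a b m m' : Fin r}
    (ha : ∀ l, s(a, l) ∈ S ↔ s(m, π l) ∈ S) (hb : ∀ l, s(b, l) ∈ S ↔ s(m', π l) ∈ S) :
    s(a, b) ∈ S ↔ s(m, m') ∈ S := by
  have hit : ∀ n l m, s(l, m) ∈ S ↔ s(π^[n] l, π^[n] m) ∈ S := by
    intro n
    induction n with
    | zero => simp
    | succ n ih =>
      intro l m
      rw [ih, h, Function.iterate_succ_apply', Function.iterate_succ_apply']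
  obtain ⟨i, p, hp⟩ : ∃ i p, π^[i] = π^[i + (p + 1)] := by
    obtain ⟨i, j, hne, hij⟩ := Finite.exists_ne_map_eq_of_infinite (fun n : ℕ => π^[n])
    rcases lt_or_gt_of_ne hne with hlt | hlt
    · exact ⟨i, j - i - 1, by rw [show i + (j - i - 1 + 1) = j by omega]; exact hij⟩
    · exact ⟨j, i - j - 1, by rw [show j + (i - j - 1 + 1) = i by omega]; exact hij.symm⟩
  have hper : ∀ x l, s(x, l) ∈ S ↔ s(x, π^[p + 1] l) ∈ S := by
    intro x l
    rw [hit i x l, hit i x (π^[p + 1] l), ← Function.iterate_add_apply, ← hp]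
  have hτ : ∀ x l, s(x, π l) ∈ S ↔ s(π^[p] x, l) ∈ S := by
    intro x l
    rw [Sym2.eq_swap, hper, Function.iterate_succ_apply', ← h, Sym2.eq_swap]
  have hab : ∀ l, s(a, l) ∈ S ↔ s(π^[p] m, l) ∈ S := fun l => (ha l).trans (hτ m l)
  have hbb : ∀ l, s(b, l) ∈ S ↔ s(π^[p] m', l) ∈ S := fun l => (hb l).trans (hτ m' l)
  rw [hab, Sym2.eq_swap, hbb, ← hit, Sym2.eq_swap]

/-- No four blocks have the same `J`-value. -/
def SmallFibers (J : B → β) : Prop :=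
  ∃ tag : B → Fin 3, ∀ b b', J b = J b' → tag b = tag b' → b = b'

/-- Among four blocks two share a tag; were the clique in the last layer, these two would coincide.
Since the first and last layers are different, every link is then a first-layer link. -/
theorem clique_first_layer (hr : 3 ≤ r) (hJ : SmallFibers J) (f : Fin 4 → B × Fin r) (m : Fin r)
    (hm : ∀ t, (f t).2 = m)
    (hadj : ∀ t t', t ≠ t' → (blockGraph ∅ I J).Adj (f t) (f t')) :
    m.val = 0 ∧ ∀ t t', I (f t).1 = I (f t').1 := by
  have key : ∀ t t', t ≠ t' →
      (m.val = 0 ∧ I (f t).1 = I (f t').1) ∨ (m.val + 1 = r ∧ J (f t).1 = J (f t').1) := by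
    intro t t' h
    have := (adj_empty_iff.1 (hadj t t' h)).2
    simp only [BlockLink, hm] at this
    rcases this with h | h | h
    · omega
    · exact Or.inl ⟨h.1, h.2.2⟩
    · exact Or.inr ⟨h.1, h.2.2⟩
  by_cases h0 : m.val = 0
  · refine ⟨h0, fun t t' => ?_⟩
    by_cases e : t = t'
    · rw [e]
    · rcases key t t' e with h | h
      · exact h.2
      · omega
  · exfalso
    obtain ⟨tag, htag⟩ := hJ
    obtain ⟨t, t', hne, heq⟩ := Fintype.exists_ne_map_eq_of_card_lt (fun t : Fin 4 => tag (f t).1)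
      (by simp)
    rcases key t t' hne with h | h
    · exact h0 h.1
    · exact (hadj t t' hne).ne (Prod.ext (htag _ _ h.2 heq) ((hm t).trans (hm t').symm))

/-- Four copies of a flipped path, with matching layers, inside a flipped block graph: the flip
looks the same from the inside and from the outside. -/
theorem mem_iff_of_four_paths (hr : 3 ≤ r) {S : Set (Sym2 (Fin r))} (hJ : SmallFibers J)
    (c : Fin 4 → Fin r → B × Fin r) (π : Fin r → Fin r) (hπ : ∀ t l, (c t l).2 = π l)
    (hinj : ∀ t l t' l', c t l = c t' l' → t = t' ∧ l = l')
    (hadj : ∀ t l t' l', (t, l) ≠ (t', l') → ((blockGraph S I J).Adj (c t l) (c t' l') ↔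
      Xor (t = t' ∧ (l.val + 1 = l'.val ∨ l'.val + 1 = l.val)) (s(l, l') ∈ S))) (l l' : Fin r) :
    s(l, l') ∈ S ↔ s(π l, π l') ∈ S := by
  set A : B × Fin r → B × Fin r → Prop := (blockGraph ∅ I J).Adj with hA
  -- `D` marks the layer pairs where the flip differs inside and outside. Between different paths it
  -- is exactly adjacency before flipping; within a path it toggles the path edges. The goal is that
  -- `D` is empty.
  set D : Fin r → Fin r → Prop := fun l l' => ¬ (s(l, l') ∈ S ↔ s(π l, π l') ∈ S) with hD
  have Asymm : ∀ {u v}, A u v → A v u := fun h => SimpleGraph.Adj.symm h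
  have Dsymm : ∀ l l', D l l' → D l' l := by
    intro l l' h
    simp only [hD] at h ⊢
    rwa [Sym2.eq_swap, Sym2.eq_swap (a := π l')]
  have hne : ∀ t l t' l', (t, l) ≠ (t', l') → c t l ≠ c t' l' := by
    intro t l t' l' h e
    obtain ⟨rfl, rfl⟩ := hinj _ _ _ _ e
    exact h rfl
  have hx : ∀ t l t' l', (t, l) ≠ (t', l') → (Xor (A (c t l) (c t' l')) (s(π l, π l') ∈ S) ↔
      Xor (t = t' ∧ (l.val + 1 = l'.val ∨ l'.val + 1 = l.val)) (s(l, l') ∈ S)) := by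
    intro t l t' l' h
    rw [← hadj t l t' l' h, adj_iff_xor (hne _ _ _ _ h), hπ, hπ]
  have hdiff : ∀ t l t' l', t ≠ t' → (A (c t l) (c t' l') ↔ D l l') := by
    intro t l t' l' h
    have := hx t l t' l' (by simp [h])
    simp only [h, false_and, xor_def] at this
    simp only [hD]
    tauto
  have hsame : ∀ t l l', l ≠ l' → (A (c t l) (c t l') ↔
      ¬ (D l l' ↔ (l.val + 1 = l'.val ∨ l'.val + 1 = l.val))) := by
    intro t l l' h
    have := hx t l t l' (by simp [h])
    simp only [true_and, xor_def] at this
    simp only [hD]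
    tauto
  have hdiag : ∀ l, D l l → (π l).val = 0 ∧ ∀ t t', I (c t l).1 = I (c t' l).1 := fun l hl =>
    clique_first_layer hr hJ (fun t => c t l) (π l) (fun t => hπ t l)
      fun t t' h => (hdiff t l t' l h).2 hl
  -- A vertex in layer `l'` of one path sees layer `l` of the three others; without `D l l` this is
  -- a claw.
  have hoff1 : ∀ l l', D l l' → D l l := by
    intro l l' h
    refine Classical.byContradiction fun hn : ¬ D l l => ?_
    refine not_claw (I := I) (J := J) hr (v := c 0 l') (a := c 1 l) (b := c 2 l) (c := c 3 l)
      (hne _ _ _ _ (by simp)) (hne _ _ _ _ (by simp)) (hne _ _ _ _ (by simp))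
      (by simp [hπ]) (by simp [hπ]) ?_ ?_ ?_ ?_ ?_ ?_
    · exact (hdiff _ _ _ _ (by decide)).2 (Dsymm _ _ h)
    · exact (hdiff _ _ _ _ (by decide)).2 (Dsymm _ _ h)
    · exact (hdiff _ _ _ _ (by decide)).2 (Dsymm _ _ h)
    · exact fun h' => hn ((hdiff _ _ _ _ (by decide)).1 h')
    · exact fun h' => hn ((hdiff _ _ _ _ (by decide)).1 h')
    · exact fun h' => hn ((hdiff _ _ _ _ (by decide)).1 h')
  -- Otherwise all vertices of both layers lie in one first-layer clique, so they are adjacent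
  -- within each path too, where `D` cancels the path edge.
  have hcons : ∀ l l', D l l' → ¬ (l.val + 1 = l'.val) := by
    intro l l' h hc
    have h1 := hdiag l (hoff1 _ _ h)
    have h2 := hdiag l' (hoff1 _ _ (Dsymm _ _ h))
    have hll : l ≠ l' := by rintro rfl; omega
    have h01 : A (c 0 l) (c 1 l') := (hdiff 0 l 1 l' (by decide)).2 h
    have hI : I (c 0 l).1 = I (c 1 l').1 := by
      have := (adj_empty_iff.1 h01).2
      simp only [BlockLink, hπ] at this
      rcases this with h | h | h
      · omega
      · exact h.2.2
      · omega
    have h00 : A (c 0 l) (c 0 l') :=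
      adj_empty_iff.2 ⟨hne _ _ _ _ (by simp [hll]), Or.inr (Or.inl
        ⟨by rw [hπ]; exact h1.1, by rw [hπ]; exact h2.1, hI.trans (h2.2 1 0)⟩)⟩
    rw [hsame 0 l l' hll] at h00
    exact h00 ⟨fun _ => Or.inl hc, fun _ => h⟩
  have hpath : ∀ t l l', l.val + 1 = l'.val → A (c t l) (c t l') := by
    intro t l l' h
    have hll : l ≠ l' := by rintro rfl; omega
    rw [hsame t l l' hll]
    exact fun e => hcons _ _ (e.2 (Or.inl h)) h
  -- leaving a clique in the first layer
  have hnext : ∀ l l', D l l → (l.val + 1 = l'.val ∨ l'.val + 1 = l.val) → ∀ t,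
      (c t l').1 = (c t l).1 ∧ (c t l').2.val = 1 := by
    intro l l' h hc t
    have h1 := hdiag l h
    have hll : l ≠ l' := by rintro rfl; omega
    have hnD : ¬ D l l' := fun h' => hc.elim (hcons _ _ h') (hcons _ _ (Dsymm _ _ h'))
    have ha : A (c t l) (c t l') := hc.elim (hpath t l l') fun h => Asymm (hpath t l' l h)
    obtain ⟨t', ht'⟩ : ∃ t' : Fin 4, t' ≠ t := exists_ne t
    have hna : ¬ A (c t' l) (c t l') := fun h => hnD ((hdiff _ _ _ _ ht').1 h)
    have e1 := (adj_empty_iff.1 ha).2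
    have e2 : ¬ BlockLink I J (c t' l) (c t l') := fun e =>
      hna (adj_empty_iff.2 ⟨hne _ _ _ _ (by simp [hll]), e⟩)
    have e3 := h1.2 t t'
    have e4 := (hπ t l).symm ▸ h1.1
    have e5 := (hπ t' l).symm ▸ h1.1
    simp only [BlockLink] at e1 e2
    generalize c t l = x at *
    generalize c t' l = y at *
    generalize c t l' = z at *
    clear_value A D
    clear hx hdiff hsame hdiag hoff1 hcons hpath hadj hinj hne hπ
    obtain ⟨x, lx⟩ := x
    obtain ⟨y, ly⟩ := y
    obtain ⟨z, lz⟩ := z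
    simp only at *
    grind
  have h00 : ∀ l : Fin r, l.val = 0 → ¬ D l l := by
    intro l hl h
    have : π l = l := Fin.ext ((hdiag l h).1.trans hl.symm)
    simp only [hD, this] at h
    tauto
  -- Read backwards, the path enters its block at layer `0` and runs to the last layer, so `π`
  -- exchanges the two end layers. Then `D` at the last layer gives `D` at layer `0`.
  have hlast : ∀ l : Fin r, l.val + 1 = r → ¬ D l l := by
    intro l hl h
    have hw := walk_eq (I := I) (J := J) (fun i => if hi : i < r then c 0 ⟨r - 1 - i, by omega⟩
      else c 0 l) (c 0 l).1 ?_ ?_ ?_ ?_ (r - 1) (by omega)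
    · simp only [show r - 1 < r by omega, dite_true, Nat.sub_self] at hw
      have h0 : (π ⟨0, by omega⟩) = l := by
        rw [← hπ 0, hw]
        exact Fin.ext (by simp; omega)
      have hl0 : π l = ⟨0, by omega⟩ := Fin.ext (hdiag l h).1
      refine h00 ⟨0, by omega⟩ rfl ?_
      simp only [hD, h0, hl0] at h ⊢
      tauto
    · intro i j hi hj e
      simp only [hi, hj, dite_true] at e
      have := (hinj _ _ _ _ e).2
      simp only [Fin.mk.injEq] at this
      omega
    · intro i hi
      simp only [show i < r by omega, hi, dite_true]
      exact Asymm (hpath _ _ _ (by simp; omega))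
    · intro h0
      simp only [h0, dite_true]
      have e : (⟨r - 1 - 0, by omega⟩ : Fin r) = l := Fin.ext (by simp; omega)
      rw [e]
      exact Prod.ext rfl (Fin.ext (by rw [hπ]; exact (hdiag l h).1))
    · intro h1
      simp only [h1, dite_true]
      have := hnext l ⟨r - 1 - 1, by omega⟩ h (Or.inr (by simp; omega)) 0
      exact Prod.ext this.1 (Fin.ext this.2)
  have hmid : ∀ l, ¬ D l l := by
    intro l h
    by_cases h0 : l.val = 0
    · exact h00 l h0 h
    by_cases h1 : l.val + 1 = r
    · exact hlast l h1 h
    -- Both path neighbors would be sent to the same vertex, in layer `1` of the block.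
    have a := hnext l ⟨l.val - 1, by omega⟩ h (Or.inr (by simp; omega)) 0
    have b := hnext l ⟨l.val + 1, by omega⟩ h (Or.inl (by simp)) 0
    have := (hinj _ _ _ _ (Prod.ext (a.1.trans b.1.symm) (Fin.ext (a.2.trans b.2.symm)))).2
    simp only [Fin.mk.injEq] at this
    omega
  by_contra h
  exact hmid l (hoff1 l l' h)

end BlockGraph

/-! ### Undoing the flip with the help of free blocks -/

namespace BlockGraph

variable {r : ℕ} {B P α β α' β' : Type} {I : B → α} {J : B → β}

/-- Pigeonhole, used with `Q` the `r ^ r` maps from layers to layers; this is the origin of the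
bound on `T`. -/
theorem exists_homogeneous {T : ℕ} {Q : Type} [Fintype Q] (hT : 3 * Fintype.card Q < T)
    (col : Fin T → Q) : ∃ (g : Fin 4 ↪ Fin T) (q : Q), ∀ t, col (g t) = q := by
  classical
  obtain ⟨q, hq⟩ := Fintype.exists_lt_card_fiber_of_mul_lt_card (f := col) (n := 3)
    (by simpa [mul_comm] using hT)
  refine ⟨(Finset.orderEmbOfCardLe _ (Nat.succ_le_of_lt hq)).toEmbedding, q, fun t => ?_⟩
  have := Finset.orderEmbOfCardLe_mem _ (Nat.succ_le_of_lt hq) t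
  simpa using this

/-- Blocks `Sum.inr t` are free if their `I`-values and `J`-values are unique. -/
def FreeBlocks {T : Type} (I : P ⊕ T → α) (J : P ⊕ T → β) : Prop :=
  ∀ t x, x ≠ Sum.inr t → I x ≠ I (Sum.inr t) ∧ J x ≠ J (Sum.inr t)

theorem not_blockLink_free {T : Type} {I : P ⊕ T → α} {J : P ⊕ T → β} (h : FreeBlocks I J)
    {u : (P ⊕ T) × Fin r} {t : T} {l : Fin r} (hu : u.1 ≠ Sum.inr t) :
    ¬ BlockLink I J u (Sum.inr t, l) := by
  rintro (h' | h' | h')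
  · exact hu h'.1
  · exact (h t _ hu).1 h'.2.2
  · exact (h t _ hu).2 h'.2.2

theorem xor_left_iff {a b c d : Prop} (h : Xor a c ↔ Xor b d) (hcd : c ↔ d) : a ↔ b := by
  unfold Xor at h
  tauto

/-- An embedding of flipped block graphs, from a block graph with many free blocks to one with
small last-layer cliques, is an embedding before flipping as well. -/
theorem embedding_unflip (hr : 3 ≤ r) {S : Set (Sym2 (Fin r))} (hJ : SmallFibers J) {T : ℕ}
    (hT : 3 * r ^ r < T) {I' : P ⊕ Fin T → α'} {J' : P ⊕ Fin T → β'} (hfree : FreeBlocks I' J')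
    (f : blockGraph S I' J' ↪g blockGraph S I J) (p q : P) (l m : Fin r) :
    (blockGraph ∅ I J).Adj (f (.inl p, l)) (f (.inl q, m)) ↔
      (blockGraph ∅ I' J').Adj (.inl p, l) (.inl q, m) := by
  obtain ⟨g, π, hπ⟩ := exists_homogeneous (by simpa using hT)
    (fun (t : Fin T) (l : Fin r) => (f (.inr t, l)).2)
  set c : Fin 4 → Fin r → B × Fin r := fun t l => f (.inr (g t), l) with hc
  have hcπ : ∀ t l, (c t l).2 = π l := fun t l => congrFun (hπ t) l
  have hadj : ∀ t l t' l', (t, l) ≠ (t', l') → ((blockGraph S I J).Adj (c t l) (c t' l') ↔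
      Xor (t = t' ∧ (l.val + 1 = l'.val ∨ l'.val + 1 = l.val)) (s(l, l') ∈ S)) := by
    intro t l t' l' h
    simp only [hc]
    rw [f.map_adj_iff, adj_iff]
    have hne : ((Sum.inr (g t), l) : (P ⊕ Fin T) × Fin r) ≠ (Sum.inr (g t'), l') := by
      simpa using h
    have : BlockLink I' J' (Sum.inr (g t), l) (Sum.inr (g t'), l') ↔
        (t = t' ∧ (l.val + 1 = l'.val ∨ l'.val + 1 = l.val)) := by
      by_cases e : t = t'
      · subst e
        have hl : l.val ≠ l'.val := fun h' => h (by rw [Fin.ext h'])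
        simp only [BlockLink, true_and, and_true]
        omega
      · simp only [e, false_and, iff_false]
        exact not_blockLink_free hfree (by simpa using e)
    rw [this]
    exact and_iff_right hne
  have hinj : ∀ t l t' l', c t l = c t' l' → t = t' ∧ l = l' := by
    intro t l t' l' h
    simpa [hc] using h
  have hS := mem_iff_of_four_paths hr hJ c π hcπ hinj hadj
  -- Because `π` preserves `S`, equal layers of different paths stay nonadjacent before flipping, so
  -- they can serve as leaves of a claw.
  have hnadj : ∀ t t' l, t ≠ t' → ¬ (blockGraph ∅ I J).Adj (c t l) (c t' l) := by
    intro t t' l h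
    have hcc : c t l ≠ c t' l := fun e => h (hinj _ _ _ _ e).1
    have := hadj t l t' l (by simp [h])
    rw [adj_iff_xor hcc, hcπ, hcπ] at this
    have := xor_left_iff this (hS l l).symm
    simp [h, this]
  -- A changed entry would make one vertex adjacent, before flipping, to layer `l'` of all four
  -- paths: a claw.
  have hrow : ∀ (p : P) (l l' : Fin r),
      s(l, l') ∈ S ↔ s((f (.inl p, l)).2, π l') ∈ S := by
    intro p l l'
    by_contra hcon
    have hall : ∀ t, (blockGraph ∅ I J).Adj (f (.inl p, l)) (c t l') := by
      intro t
      have h1 : ((Sum.inl p, l) : (P ⊕ Fin T) × Fin r) ≠ (Sum.inr (g t), l') := by simp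
      have h2 : f (.inl p, l) ≠ c t l' := fun e => h1 (f.injective e)
      have h3 := f.map_adj_iff (v := (.inl p, l)) (w := (.inr (g t), l'))
      change (blockGraph S I J).Adj _ (c t l') ↔ _ at h3
      rw [adj_iff_xor h2, hcπ, adj_iff (I := I')] at h3
      have h4 := not_blockLink_free (r := r) hfree (u := (.inl p, l)) (t := g t) (l := l') (by simp)
      simp only [h4, ne_eq, h1, not_false_eq_true, true_and, xor_def] at h3
      tauto
    have hne : ∀ t t', t ≠ t' → c t l' ≠ c t' l' := fun t t' h e => h (hinj _ _ _ _ e).1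
    exact not_claw hr (hne 0 1 (by decide)) (hne 0 2 (by decide)) (hne 1 2 (by decide))
      (by rw [hcπ, hcπ]) (by rw [hcπ, hcπ]) (hall 0) (hall 1) (hall 2)
      (hnadj _ _ _ (by decide)) (hnadj _ _ _ (by decide)) (hnadj _ _ _ (by decide))
  by_cases e : ((Sum.inl p, l) : (P ⊕ Fin T) × Fin r) = (.inl q, m)
  · rw [e]
    simp
  · have e' : f (.inl p, l) ≠ f (.inl q, m) := fun h => e (f.injective h)
    have h := f.map_adj_iff (v := (.inl p, l)) (w := (.inl q, m))
    rw [adj_iff_xor e, adj_iff_xor e'] at h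
    exact xor_left_iff h (mem_iff_of_layer_map hS (hrow p l) (hrow q m)).symm

/-- In an embedding of block graphs, a block whose first layer lies in a clique on four vertices is
mapped onto a block, layer by layer. -/
theorem exists_block_of_clique (hr : 3 ≤ r) (hJ : SmallFibers J) {P : Type} {I' : P → α'}
    {J' : P → β'} (f : P × Fin r → B × Fin r) (hf : Function.Injective f)
    (hadj : ∀ u v, (blockGraph ∅ I J).Adj (f u) (f v) ↔ (blockGraph ∅ I' J').Adj u v)
    (k : Fin 4 ↪ P) (hk : ∀ t t', I' (k t) = I' (k t')) (t : Fin 4) :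
    ∃ b, ∀ l, f (k t, l) = (b, l) := by
  let z : Fin r := ⟨0, by omega⟩
  have hcl : ∀ t t', t ≠ t' → (blockGraph ∅ I J).Adj (f (k t, z)) (f (k t', z)) := by
    intro t t' h
    rw [hadj, adj_empty_iff]
    exact ⟨by simpa using h, Or.inr (Or.inl ⟨rfl, rfl, hk t t'⟩)⟩
  have hlay : ∀ t t', (f (k t, z)).2 = (f (k t', z)).2 := by
    intro t t'
    by_cases h : t = t'
    · rw [h]
    obtain ⟨s, hs⟩ : ∃ s : Fin 4, s ≠ t ∧ s ≠ t' := by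
      clear hcl hk; revert t t'; decide
    exact layer_eq_of_triangle hr (hcl _ _ h) (hcl _ _ hs.1.symm) (hcl _ _ hs.2.symm)
  obtain ⟨h0, hI⟩ := clique_first_layer hr hJ (fun t => f (k t, z)) (f (k t, z)).2
    (fun t' => hlay t' t) hcl
  have hstep : ∀ i (h : i + 1 < r),
      (blockGraph ∅ I J).Adj (f (k t, ⟨i, by omega⟩)) (f (k t, ⟨i + 1, h⟩)) := by
    intro i h
    rw [hadj, adj_empty_iff]
    exact ⟨by simp, Or.inl ⟨rfl, Or.inl rfl⟩⟩
  -- The second vertex sees one member of the first-layer clique but not another, so it can only be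
  -- reached by the path edge into layer `1`.
  have h1 : f (k t, ⟨1, by omega⟩) = ((f (k t, z)).1, ⟨1, by omega⟩) := by
    obtain ⟨t', ht'⟩ : ∃ t' : Fin 4, t' ≠ t := exists_ne t
    have ha := (adj_empty_iff.1 (hstep 0 (by omega))).2
    have hna : ¬ (blockGraph ∅ I J).Adj (f (k t', z)) (f (k t, ⟨1, by omega⟩)) := by
      rw [hadj, adj_empty_iff]
      rintro ⟨-, h | h | h⟩
      · exact ht' (k.injective h.1)
      · simp at h
      · simp only [z] at h
        omega
    have hne : f (k t', z) ≠ f (k t, ⟨1, by omega⟩) := fun e => by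
      have := hf e
      simp [z] at this
    have hna' : ¬ BlockLink I J (f (k t', z)) (f (k t, ⟨1, by omega⟩)) := fun e =>
      hna (adj_empty_iff.2 ⟨hne, e⟩)
    have hIt := hI t t'
    have hl' := hlay t' t
    change BlockLink I J (f (k t, z)) _ at ha
    simp only [BlockLink, hl', h0] at ha hna'
    refine Prod.ext ?_ (Fin.ext ?_)
    · grind
    · grind
  refine ⟨(f (k t, z)).1, fun l => ?_⟩
  have hw := walk_eq (I := I) (J := J)
    (fun i => if hi : i < r then f (k t, ⟨i, hi⟩) else f (k t, z)) (f (k t, z)).1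
    ?_ ?_ ?_ ?_ l.val l.isLt
  · simpa using hw
  · intro i j hi hj e
    simp only [hi, hj, dite_true] at e
    simpa using hf e
  · intro i hi
    simp only [show i < r by omega, hi, dite_true]
    exact hstep i hi
  · intro h
    simp only [h, dite_true]
    exact Prod.ext rfl (Fin.ext h0)
  · intro h
    simp only [h, dite_true]
    exact h1

end BlockGraph

/-! ### Unflipped embeddings and adjacency in the end layers -/

namespace BlockGraph

variable {r : ℕ} {B P α β α' β' : Type} {I : B → α} {J : B → β}

/-- The restriction to the non-free blocks of an embedding of flipped block graphs, seen as an
embedding of block graphs. -/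
def unflip (hr : 3 ≤ r) {S : Set (Sym2 (Fin r))} (hJ : SmallFibers J) {T : ℕ}
    (hT : 3 * r ^ r < T) {I' : P ⊕ Fin T → α'} {J' : P ⊕ Fin T → β'} (hfree : FreeBlocks I' J')
    (f : blockGraph S I' J' ↪g blockGraph S I J) :
    blockGraph (r := r) ∅ (I' ∘ Sum.inl) (J' ∘ Sum.inl) ↪g blockGraph (r := r) ∅ I J where
  toFun u := f (.inl u.1, u.2)
  inj' := by
    rintro ⟨p, l⟩ ⟨q, m⟩ h
    simpa using f.injective h
  map_rel_iff' := by
    rintro ⟨p, l⟩ ⟨q, m⟩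
    change (blockGraph ∅ I J).Adj (f (.inl p, l)) (f (.inl q, m)) ↔ _
    rw [embedding_unflip hr hJ hT hfree]
    simp [adj_empty_iff, BlockLink]

theorem adj_first_layer (hr : 3 ≤ r) {b c : B} (z : Fin r) (hz : z.val = 0) :
    (blockGraph ∅ I J).Adj (b, z) (c, z) ↔ b ≠ c ∧ I b = I c := by
  simp only [adj_empty_iff, BlockLink, ne_eq, Prod.mk.injEq, and_true]
  refine and_congr_right fun _ => ⟨?_, fun h => Or.inr (Or.inl ⟨hz, hz, h⟩)⟩
  rintro (h | h | h)
  · omega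
  · exact h.2.2
  · omega

theorem adj_last_layer (hr : 3 ≤ r) {b c : B} (z : Fin r) (hz : z.val + 1 = r) :
    (blockGraph ∅ I J).Adj (b, z) (c, z) ↔ b ≠ c ∧ J b = J c := by
  simp only [adj_empty_iff, BlockLink, ne_eq, Prod.mk.injEq, and_true]
  refine and_congr_right fun _ => ⟨?_, fun h => Or.inr (Or.inr ⟨hz, hz, h⟩)⟩
  rintro (h | h | h)
  · omega
  · omega
  · exact h.2.2

end BlockGraph

/-! ### The block graph encoding a graph -/

namespace Encoding

open BlockGraph

/-- The blocks used to encode a graph with `n` vertices: for every vertex `u` a block for every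
vertex `v`, a marker block (slot `0`), three blocks making the first-layer clique of `u` large
(slots `1`, `2`, `3`), two blocks completing the last-layer clique of the marker block to a triangle
(slots `4`, `5`), and moreover `T` free blocks. -/
abbrev Block (n T : ℕ) : Type := Fin n × (Fin n ⊕ Fin 6) ⊕ Fin T

variable {n T r : ℕ} {H : SimpleGraph (Fin n)}

/-- The representative of the first-layer clique of a block. -/
def first : Block n T → Block n T
  | .inl (u, .inl _) => .inl (u, .inr 0)
  | .inl (u, .inr j) => if j.val < 4 then .inl (u, .inr 0) else .inl (u, .inr j)
  | .inr t => .inr t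

open Classical in
/-- The representative of the last-layer clique of a block. -/
noncomputable def last (H : SimpleGraph (Fin n)) : Block n T → Block n T
  | .inl (u, .inl v) => if H.Adj u v ∧ v < u then .inl (v, .inl u) else .inl (u, .inl v)
  | .inl (u, .inr j) => if j = 0 ∨ 4 ≤ j.val then .inl (u, .inr 0) else .inl (u, .inr j)
  | .inr t => .inr t

/-- Within one first-layer clique all last-layer representatives differ. Hence the blocks are
distinct cells of a grid, which places the encoding inside a biweb. -/
theorem eq_of_first_eq_of_last_eq {b c : Block n T} (h : first b = first c)
    (h' : last H b = last H c) : b = c := by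
  rcases b with ⟨u, v | j⟩ | t <;> rcases c with ⟨u', v' | j'⟩ | t' <;>
    simp only [first, last] at h h' <;> grind

/-- The nontrivial last-layer cliques are the pairs `(u, v)`, `(v, u)` of an edge and the triples of
slots `0`, `4`, `5`. -/
theorem smallFibers_last : SmallFibers (last (T := T) H) := by
  refine ⟨fun b => match b with
    | .inl (u, .inl v) => if v < u then 0 else 1
    | .inl (_, .inr j) => if j.val = 4 then 1 else if j.val = 5 then 2 else 0
    | .inr _ => 0, ?_⟩
  intro b c h h'
  rcases b with ⟨u, v | j⟩ | t <;> rcases c with ⟨u', v' | j'⟩ | t' <;>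
    simp only [last] at h h' <;> grind

/-- The flipped block graph encoding `H`. -/
noncomputable abbrev graph (T : ℕ) (S : Set (Sym2 (Fin r))) (H : SimpleGraph (Fin n)) :
    SimpleGraph (Block n T × Fin r) :=
  blockGraph S first (last H)

/-! #### The pattern for the domain -/

/-- First-layer cliques in the pattern for the domain. -/
def domFirst : Fin 6 ⊕ Fin T → Fin 6 ⊕ Fin T
  | .inl j => if j.val < 4 then .inl 0 else .inl j
  | .inr t => .inr t

/-- Last-layer cliques in the pattern for the domain. -/
def domLast : Fin 6 ⊕ Fin T → Fin 6 ⊕ Fin T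
  | .inl j => if j = 0 ∨ 4 ≤ j.val then .inl 0 else .inl j
  | .inr t => .inr t

theorem freeBlocks_dom : FreeBlocks (domFirst (T := T)) domLast := by
  rintro t (j | t') h
  · simp only [domFirst, domLast]
    grind
  · simpa [domFirst, domLast] using h

/-- The pattern for the domain in the encoding of a graph. -/
noncomputable def domEmbedding (S : Set (Sym2 (Fin r))) (H : SimpleGraph (Fin n)) (u : Fin n) :
    blockGraph S (domFirst (T := T)) domLast ↪g graph T S H :=
  BlockGraph.embedding S (Sum.map (fun j => (u, .inr j)) id)
    (by
      rintro (j | t) (j' | t') h <;> simp_all)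
    (by
      rintro (j | t) (j' | t') <;> simp [domFirst, first] <;> grind)
    (by
      rintro (j | t) (j' | t') <;> simp [domLast, last] <;> grind)

/-- The block of the root shares its first-layer clique with another block, which excludes slots
`4`, `5` and free blocks, and lies in a last-layer triangle, which excludes edge blocks and slots
`1`, `2`, `3`. Only the marker remains. -/
theorem exists_dom_iff (hr : 3 ≤ r) (S : Set (Sym2 (Fin r))) (hT : 3 * r ^ r < T) (z : Fin r)
    (hz : z.val = 0) (x : Block n T × Fin r) :
    (∃ f : blockGraph S (domFirst (T := T)) domLast ↪g graph T S H,
      f (.inl 0, z) = x) ↔ ∃ u : Fin n, x = (.inl (u, .inr 0), z) := by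
  constructor
  · rintro ⟨f, rfl⟩
    let g := unflip hr smallFibers_last hT freeBlocks_dom f
    let k : Fin 4 ↪ Fin 6 := Fin.castLEEmb (by omega)
    obtain ⟨κ, hκ⟩ := Classical.axiom_of_choice (exists_block_of_clique hr smallFibers_last g
      g.injective (fun u v => g.map_adj_iff) k (by
        intro t t'
        have h1 : ((k t).val) < 4 := t.isLt
        have h2 : ((k t').val) < 4 := t'.isLt
        simp [domFirst, h1, h2]))
    have hκinj : Function.Injective κ := by
      intro t t' h
      have := g.injective (((hκ t z).trans (by rw [h])).trans (hκ t' z).symm)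
      simpa using this
    have h01 : first (κ 0) = first (κ 1) := by
      have : (blockGraph ∅ first (last H)).Adj (g (k 0, z)) (g (k 1, z)) := by
        rw [g.map_adj_iff, adj_first_layer hr z hz]
        exact ⟨fun h => by simpa using k.injective h, rfl⟩
      rw [hκ, hκ, adj_first_layer hr z hz] at this
      exact this.2
    let y : Fin r := ⟨r - 1, by omega⟩
    have hy : y.val + 1 = r := by simp only [y]; omega
    have hadj : ∀ i j : Fin 6, i ≠ j → (i = 0 ∨ 4 ≤ i.val) → (j = 0 ∨ 4 ≤ j.val) →
        (blockGraph ∅ first (last H)).Adj (g (i, y)) (g (j, y)) := by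
      intro i j hij hi hj
      rw [g.map_adj_iff, adj_last_layer hr y hy]
      refine ⟨hij, ?_⟩
      simp [domLast, hi, hj]
    have h0 : g (0, y) = (κ 0, y) := hκ 0 y
    have a4 := hadj 0 4 (by decide) (by decide) (by decide)
    have a5 := hadj 0 5 (by decide) (by decide) (by decide)
    have a45 := hadj 4 5 (by decide) (by decide) (by decide)
    -- Blocks `4` and `5` are in no large first-layer clique, so they are not known to go to whole
    -- blocks; the triangle still keeps their last vertices in the last layer.
    have e4 : g (4, y) = ((g (4, y)).1, y) := Prod.ext rfl
      ((layer_eq_of_triangle hr a4 a5 a45).symm.trans (by rw [h0]))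
    have e5 : g (5, y) = ((g (5, y)).1, y) := Prod.ext rfl
      ((layer_eq_of_triangle hr a5 a4 a45.symm).symm.trans (by rw [h0]))
    rw [h0, e4, adj_last_layer hr y hy] at a4
    rw [h0, e5, adj_last_layer hr y hy] at a5
    rw [e4, e5, adj_last_layer hr y hy] at a45
    have hfin : f (.inl 0, z) = (κ 0, z) := hκ 0 z
    have hne : κ 0 ≠ κ 1 := fun h => by simpa using hκinj h
    rw [hfin]
    generalize κ 0 = b at *
    generalize κ 1 = c at *
    generalize (g (4, y)).1 = d at *
    generalize (g (5, y)).1 = d' at *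
    suffices ∃ u, b = .inl (u, .inr 0) by
      obtain ⟨u, rfl⟩ := this
      exact ⟨u, rfl⟩
    obtain ⟨a4, b4⟩ := a4
    obtain ⟨a5, b5⟩ := a5
    obtain ⟨a45, -⟩ := a45
    clear hfin h0 hadj e4 e5 hκ hκinj
    rcases b with ⟨u, v | j⟩ | t
    · exfalso
      rcases d with ⟨u1, v1 | j1⟩ | t1 <;> rcases d' with ⟨u2, v2 | j2⟩ | t2 <;>
        simp only [last] at b4 b5 <;> grind
    · refine ⟨u, ?_⟩
      by_cases hj : j = 0
      · rw [hj]
      exfalso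
      by_cases hj4 : j.val < 4
      · rcases d with ⟨u1, v1 | j1⟩ | t1 <;> simp only [last] at b4 <;> grind
      · rcases c with ⟨u1, v1 | j1⟩ | t1 <;> simp only [first] at h01 <;> grind
    · exfalso
      rcases c with ⟨u1, v1 | j1⟩ | t1 <;> simp only [first] at h01 <;> grind
  · rintro ⟨u, rfl⟩
    exact ⟨domEmbedding S H u, rfl⟩

/-! #### The pattern for the edges -/

/-- First-layer cliques in the pattern for the edges. -/
def edgeFirst : Bool × Fin 4 ⊕ Fin T → Bool × Fin 4 ⊕ Fin T
  | .inl (s, _) => .inl (s, 0)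
  | .inr t => .inr t

/-- Last-layer cliques in the pattern for the edges. -/
def edgeLast : Bool × Fin 4 ⊕ Fin T → Bool × Fin 4 ⊕ Fin T
  | .inl (s, j) => if j = 1 then .inl (true, 1) else .inl (s, j)
  | .inr t => .inr t

theorem freeBlocks_edge : FreeBlocks (edgeFirst (T := T)) edgeLast := by
  rintro t (⟨s, j⟩ | t') h
  · simp only [edgeFirst, edgeLast]
    grind
  · simpa [edgeFirst, edgeLast] using h

/-- The symmetry of the pattern for the edges. -/
def edgeSwap (S : Set (Sym2 (Fin r))) :
    blockGraph S (edgeFirst (T := T)) edgeLast ↪g blockGraph S (edgeFirst (T := T)) edgeLast :=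
  BlockGraph.embedding S (Sum.map (fun p => (!p.1, p.2)) id)
    (by
      rintro (⟨s, j⟩ | t) (⟨s', j'⟩ | t') h <;> simp_all)
    (by
      rintro (⟨s, j⟩ | t) (⟨s', j'⟩ | t') <;> simp [edgeFirst])
    (by
      rintro (⟨s | s, j⟩ | t) (⟨s' | s', j'⟩ | t') <;> simp [edgeLast] <;> grind)

/-- The blocks of the pattern for the edges in the encoding of a graph with an edge `uv`. -/
def edgeBlock (u v : Fin n) : Bool × Fin 4 ⊕ Fin T → Block n T
  | .inl (s, 0) => .inl (bif s then v else u, .inr 0)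
  | .inl (s, 1) => .inl (bif s then v else u, .inl (bif s then u else v))
  -- Blocks `2` and `3` only bring the first-layer clique up to four members.
  | .inl (s, 2) => .inl (bif s then v else u, .inr 1)
  | .inl (s, 3) => .inl (bif s then v else u, .inr 2)
  | .inr t => .inr t

/-- The pattern for the edges in the encoding of a graph. -/
noncomputable def edgeEmbedding (S : Set (Sym2 (Fin r))) (u v : Fin n) (h : H.Adj u v) :
    blockGraph S (edgeFirst (T := T)) edgeLast ↪g graph T S H :=
  BlockGraph.embedding S (edgeBlock u v)
    (by
      have h1 := h.ne
      have h2 := h1.symm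
      rintro (⟨s | s, j⟩ | t) (⟨s' | s', j'⟩ | t') h <;> (try fin_cases j) <;>
        (try fin_cases j') <;> simp_all [edgeBlock])
    (by
      have h1 := h.ne
      have h2 := h1.symm
      rintro (⟨s | s, j⟩ | t) (⟨s' | s', j'⟩ | t') <;> (try fin_cases j) <;>
        (try fin_cases j') <;> simp [edgeBlock, first, edgeFirst, h1, h2])
    (by
      have h1 := h.ne
      have h2 := h1.symm
      have h3 := h.symm
      rcases lt_or_gt_of_ne h1 with h4 | h4 <;> have h5 := h4.not_gt <;>
      rintro (⟨s | s, j⟩ | t) (⟨s' | s', j'⟩ | t') <;> (try fin_cases j) <;>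
        (try fin_cases j') <;> simp [edgeBlock, last, edgeLast, h, h1, h2, h3, h4, h5])

/-- Both sides of the pattern are first-layer cliques of size four, so they go to whole blocks, in
the cliques of `u` and of `v`. Distinct blocks from these that share a last-layer clique must be
`(u, v)` and `(v, u)`, linked only for an edge; the last-layer partners of a marker are outside
these cliques. -/
theorem exists_edge_iff (hr : 3 ≤ r) (S : Set (Sym2 (Fin r))) (hT : 3 * r ^ r < T) (z : Fin r)
    (hz : z.val = 0) (u v : Fin n) :
    (∃ f : blockGraph S (edgeFirst (T := T)) edgeLast ↪g graph T S H,
      f (.inl (false, 0), z) = (.inl (u, .inr 0), z) ∧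
      f (.inl (true, 0), z) = (.inl (v, .inr 0), z)) ↔ H.Adj u v := by
  constructor
  · rintro ⟨f, hu, hv⟩
    let g := unflip hr smallFibers_last hT freeBlocks_edge f
    have hex : ∀ p : Bool × Fin 4, ∃ b, ∀ l, g (p, l) = (b, l) := by
      rintro ⟨s, t⟩
      exact exists_block_of_clique hr smallFibers_last g g.injective (fun u v => g.map_adj_iff)
        ⟨fun t => (s, t), fun t t' h => (Prod.mk.inj h).2⟩ (fun t t' => rfl) t
    obtain ⟨κ, hκ⟩ := Classical.axiom_of_choice hex
    have hκinj : Function.Injective κ := by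
      intro t t' h
      have := g.injective (((hκ t z).trans (by rw [h])).trans (hκ t' z).symm)
      simpa using this
    have hI : ∀ s, first (κ (s, 1)) = first (κ (s, 0)) := by
      intro s
      have : (blockGraph ∅ first (last H)).Adj (g ((s, 1), z)) (g ((s, 0), z)) := by
        rw [g.map_adj_iff, adj_first_layer hr z hz]
        exact ⟨by simp, rfl⟩
      rw [hκ, hκ, adj_first_layer hr z hz] at this
      exact this.2
    have hJ : κ (false, 1) ≠ κ (true, 1) ∧ last H (κ (false, 1)) = last H (κ (true, 1)) := by
      let y : Fin r := ⟨r - 1, by omega⟩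
      have hy : y.val + 1 = r := by simp only [y]; omega
      have : (blockGraph ∅ first (last H)).Adj (g ((false, 1), y)) (g ((true, 1), y)) := by
        rw [g.map_adj_iff, adj_last_layer hr y hy]
        exact ⟨by simp, rfl⟩
      rwa [hκ, hκ, adj_last_layer hr y hy] at this
    have h0 : κ (false, 0) = .inl (u, .inr 0) :=
      congrArg Prod.fst ((hκ (false, 0) z).symm.trans hu)
    have h1 : κ (true, 0) = .inl (v, .inr 0) :=
      congrArg Prod.fst ((hκ (true, 0) z).symm.trans hv)
    have hIu := (hI false).trans (congrArg first h0)
    have hIv := (hI true).trans (congrArg first h1)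
    obtain ⟨hne, hJ⟩ := hJ
    generalize κ (false, 1) = b at *
    generalize κ (true, 1) = c at *
    clear hκ hκinj hI
    rcases b with ⟨u1, v1 | j1⟩ | t1 <;> rcases c with ⟨u2, v2 | j2⟩ | t2 <;>
      simp only [first, last] at hIu hIv hJ <;> have := @H.adj_comm <;> grind
  · intro h
    exact ⟨edgeEmbedding S u v h, rfl, rfl⟩

end Encoding

/-! ### The interpretation obtained from the two patterns -/

namespace Encoding

open BlockGraph

variable {r T : ℕ}

/-- On arbitrary graphs, `edgeSwap` makes the edge formula symmetric and injectivity of embeddings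
makes it irreflexive. On an encoding, the domain consists of the first vertices of the markers. -/
theorem exists_interpretation (hr : 3 ≤ r) (S : Set (Sym2 (Fin r))) (hT : 3 * r ^ r < T) :
    ∃ I : Interpretation, I.Existential ∧
      ∀ (n : ℕ) (H : SimpleGraph (Fin n)) (V : Type) [Finite V] (G : SimpleGraph V),
        Nonempty (graph T S H ≃g G) → Nonempty (I.apply G ≃g H) := by
  let z : Fin r := ⟨0, by omega⟩
  obtain ⟨δ, hδ, hδS⟩ := InducedCopy.exists_formula (blockGraph S (domFirst (T := T)) domLast)
    (fun _ : Fin 1 => (.inl 0, z))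
  obtain ⟨φ, hφ, hφS⟩ := InducedCopy.exists_formula (blockGraph S (edgeFirst (T := T)) edgeLast)
    (fun i : Fin 2 => (.inl (decide (i = 1), 0), z))
  simp only [Fin.forall_fin_one, Fin.forall_fin_two] at hδS hφS
  refine ⟨⟨δ, φ, ?_, ?_⟩, ⟨hδ, hφ⟩, ?_⟩
  · intro V _ G u h
    obtain ⟨f, h0, h1⟩ := (hφS V G _).1 h
    simpa using f.injective (h0.trans h1.symm)
  · intro V _ G u v h
    obtain ⟨f, h0, h1⟩ := (hφS V G _).1 h
    exact (hφS V G _).2 ⟨(edgeSwap S).trans f, h1, h0⟩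
  · rintro n H V _ G ⟨e⟩
    have hdom : ∀ x, Sat G δ ![e x] ↔ ∃ u : Fin n, x = (.inl (u, .inr 0), z) := by
      intro x
      rw [hδS, ← exists_dom_iff hr S hT z rfl]
      constructor
      · rintro ⟨f, hf⟩
        refine ⟨f.trans e.symm.toEmbedding, ?_⟩
        exact e.symm_apply_eq.2 hf
      · rintro ⟨f, hf⟩
        exact ⟨f.trans e.toEmbedding, congrArg e hf⟩
    have hedge : ∀ u v : Fin n, Sat G φ ![e (.inl (u, .inr 0), z), e (.inl (v, .inr 0), z)] ↔
        H.Adj u v := by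
      intro u v
      rw [hφS, ← exists_edge_iff (T := T) hr S hT z rfl]
      constructor
      · rintro ⟨f, hf, hf'⟩
        exact ⟨f.trans e.symm.toEmbedding, e.symm_apply_eq.2 hf, e.symm_apply_eq.2 hf'⟩
      · rintro ⟨f, hf, hf'⟩
        exact ⟨f.trans e.toEmbedding, congrArg e hf, congrArg e hf'⟩
    let g : Fin n → {v : V // Sat G δ ![v]} := fun u =>
      ⟨e (.inl (u, .inr 0), z), (hdom _).2 ⟨u, rfl⟩⟩
    have hg : Function.Bijective g := by
      constructor
      · intro u v h
        simpa [g] using h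
      · rintro ⟨v, hv⟩
        obtain ⟨x, rfl⟩ := e.surjective v
        obtain ⟨u, rfl⟩ := (hdom x).1 hv
        exact ⟨u, rfl⟩
    refine ⟨(⟨Equiv.ofBijective g hg, ?_⟩ : H ≃g _).symm⟩
    intro u v
    exact hedge u v

end Encoding

/-! ### Uniform flips of biwebs -/

namespace Biweb

open BlockGraph

variable {r : ℕ}

/-- Bipartite Ramsey theorem: a coloring of a large grid is constant on a large subgrid. -/
theorem exists_monochromatic_subgrid (Q : Type) [Fintype Q] (n : ℕ) :
    ∃ N M : ℕ, ∀ col : Fin N → Fin M → Q, ∃ (f g : Fin n ↪ Fin _) (q : Q),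
      ∀ i j, col (f i) (g j) = q := by
  have hsub : ∀ (A D : Type) [Fintype A] [Fintype D] (φ : A → D),
      Fintype.card D * n < Fintype.card A → ∃ (f : Fin n ↪ A) (d : D), ∀ i, φ (f i) = d := by
    classical
    intro A D _ _ φ h
    obtain ⟨d, hd⟩ := Fintype.exists_lt_card_fiber_of_mul_lt_card φ h
    obtain ⟨f⟩ : Nonempty (Fin n ↪ {a // a ∈ Finset.univ.filter (φ · = d)}) :=
      Function.Embedding.nonempty_of_card_le (by
        rw [Fintype.card_fin, Fintype.card_coe]; exact hd.le)
    exact ⟨f.trans (Function.Embedding.subtype _), d, fun i => (Finset.mem_filter.1 (f i).2).2⟩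
  -- First `n` columns with the same color vector are found, the colors being all vectors over the
  -- rows; then `n` rows with the same entry in that vector.
  refine ⟨Fintype.card Q * n + 1, Fintype.card (Fin (Fintype.card Q * n + 1) → Q) * n + 1,
    fun col => ?_⟩
  obtain ⟨g, row, hg⟩ := hsub _ _ (fun j i => col i j) (by simp)
  obtain ⟨f, q, hf⟩ := hsub _ _ row (by simp)
  exact ⟨f, g, q, fun i j => (congrFun (hg j) (f i)).trans (hf i)⟩

/-- Without its native vertices a biweb is the block graph whose blocks are the edges `(i, j)`, with
the two ends as clique labels. -/
theorem biweb_adj_inr {n m : ℕ} (i i' : Fin n) (j j' : Fin m) (p p' : Fin r) :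
    (biweb r n m).Adj (.inr (i, j, p)) (.inr (i', j', p')) ↔
      (i, j, p) ≠ (i', j', p') ∧ ((i = i' ∧ j = j' ∧ (p.val + 1 = p'.val ∨ p'.val + 1 = p.val)) ∨
        (p.val = 0 ∧ p'.val = 0 ∧ i = i') ∨ (p.val + 1 = r ∧ p'.val + 1 = r ∧ j = j')) := by
  simp only [biweb, subdividedBiclique, SimpleGraph.fromRel_adj, ne_eq, Sum.exists]
  simp
  grind

/-- `C` contains all block graphs with at most `K` values on both ends, flipped by `S`. -/
def ContainsBlockGraphs (C : GraphClass) (r K : ℕ) (S : Set (Sym2 (Fin r))) : Prop :=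
  ∀ (V : Type) [Finite V] (G : SimpleGraph V) (B : Type) (I J : B → Fin K),
    (∀ b c, I b = I c → J b = J c → b = c) → Nonempty (G ↪g blockGraph S I J) → C V G

/-- On a subgrid with constant color vector the flip depends only on layers. A block is placed in
the cell given by its two labels, and distinct blocks get distinct cells. -/
theorem exists_containsBlockGraphs (k : ℕ) (C : GraphClass) (hC : C.Hereditary)
    (hflip : ∀ n m : ℕ, ∃ G : SimpleGraph (BiwebVertex r n m),
      IsFlip k (biweb r n m) G ∧ C (BiwebVertex r n m) G) (K : ℕ) :
    ∃ S, ContainsBlockGraphs C r K S := by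
  obtain ⟨N, M, hNM⟩ := exists_monochromatic_subgrid (Fin r → Fin k) K
  obtain ⟨G, ⟨col, R, hR, hG⟩, hCG⟩ := hflip N M
  obtain ⟨f, g, q, hq⟩ := hNM (fun i j p => col (.inr (i, j, p)))
  have hq : ∀ i j p, col (.inr (f i, g j, p)) = q p := fun i j p => congrFun (hq i j) p
  refine ⟨Sym2.fromRel (r := fun l m => R (q l) (q m)) ⟨fun l m h => hR _ _ h⟩, ?_⟩
  rintro V _ G' B I J hIJ ⟨e⟩
  refine hC _ _ G G' hCG ⟨e.trans ⟨⟨fun u => .inr (f (I u.1), g (J u.1), u.2), ?_⟩, ?_⟩⟩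
  · rintro ⟨b, l⟩ ⟨c, m⟩ h
    simp only [Sum.inr.injEq, Prod.mk.injEq, EmbeddingLike.apply_eq_iff_eq] at h
    simp [hIJ _ _ h.1 h.2.1, h.2.2]
  · rintro ⟨b, l⟩ ⟨c, m⟩
    change G.Adj (.inr (f (I b), g (J b), l)) (.inr (f (I c), g (J c), m)) ↔ _
    by_cases hbc : (b, l) = (c, m)
    · simp only [Prod.mk.injEq] at hbc
      simp [hbc]
    have hne : (f (I b), g (J b), l) ≠ (f (I c), g (J c), m) := by
      intro h
      simp only [Prod.mk.injEq, EmbeddingLike.apply_eq_iff_eq] at h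
      exact hbc (by simp [hIJ _ _ h.1 h.2.1, h.2.2])
    rw [hG _ _ (by simpa using hne), hq, hq, biweb_adj_inr, adj_iff]
    have hb : b = c ↔ I b = I c ∧ J b = J c :=
      ⟨fun h => by simp [h], fun h => hIJ _ _ h.1 h.2⟩
    simp only [hne, hbc, ne_eq, not_false_eq_true, true_and, EmbeddingLike.apply_eq_iff_eq,
      BlockLink, Sym2.fromRel_prop, hb, and_assoc]

/-- If each of the finitely many `S` failed at some size, the sum of these sizes would bound all of
them, yet some `S` succeeds there and hence at every smaller size. -/
theorem exists_forall_containsBlockGraphs (k : ℕ) (C : GraphClass)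
    (hC : C.Hereditary) (hflip : ∀ n m : ℕ, ∃ G : SimpleGraph (BiwebVertex r n m),
      IsFlip k (biweb r n m) G ∧ C (BiwebVertex r n m) G) :
    ∃ S, ∀ K, ContainsBlockGraphs C r K S := by
  by_contra! h
  choose K hK using h
  obtain ⟨S, hS⟩ := exists_containsBlockGraphs k C hC hflip (∑ᶠ S, K S)
  have hle : K S ≤ ∑ᶠ S, K S :=
    single_le_finsum S (Set.toFinite _) (fun _ => Nat.zero_le _)
  refine hK S ?_
  rintro V _ G B I J hIJ ⟨e⟩
  refine hS V G B (Fin.castLE hle ∘ I) (Fin.castLE hle ∘ J) (by simpa using hIJ)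
    ⟨e.trans (BlockGraph.embedding S id Function.injective_id ?_ ?_)⟩ <;> simp

end Biweb

/-! ### Reasoning about programs of the machine -/

namespace RAM

infixr:60 " ;; " => RAM.Prog.seq

/-- The program `P`, started in `s`, halts within `T` steps in a state satisfying `R`. -/
def Halts (P : Prog) (s : State) (T : ℕ) (R : State → Prop) : Prop :=
  ∃ t s', t ≤ T ∧ Run P s t s' ∧ R s'

namespace State

@[simp] theorem reg_setReg (s : State) (x a y : ℕ) :
    (s.setReg x a).reg y = if y = x then a else s.reg y := by
  simp [setReg, Function.update_apply]

@[simp] theorem arr_setReg (s : State) (x a : ℕ) : (s.setReg x a).arr = s.arr := rfl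

@[simp] theorem reg_setArr (s : State) (A i a : ℕ) : (s.setArr A i a).reg = s.reg := rfl

@[simp] theorem arr_setArr (s : State) (A i a B j : ℕ) :
    (s.setArr A i a).arr B j = if B = A ∧ j = i then a else s.arr B j := by
  by_cases h : B = A
  · subst h
    simp [setArr, Function.update_apply]
  · simp [setArr, h]

end State

namespace Halts

variable {P Q P' : Prog} {s : State} {T T' x c y z A i : ℕ} {R R' : State → Prop}

theorem mono (h : Halts P s T R) (hT : T ≤ T') (hR : ∀ s, R s → R' s) : Halts P s T' R' := by
  obtain ⟨t, s', ht, hrun, hs'⟩ := h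
  exact ⟨t, s', ht.trans hT, hrun, hR _ hs'⟩

theorem seq (h : Halts P s T R) (h' : ∀ s', R s' → Halts Q s' T' R') :
    Halts (P ;; Q) s (T + T') R' := by
  obtain ⟨t, s', ht, hrun, hs'⟩ := h
  obtain ⟨t', s'', ht', hrun', hs''⟩ := h' s' hs'
  exact ⟨t + t', s'', Nat.add_le_add ht ht', .seq hrun hrun', hs''⟩

/-- Lets the one-instruction rules apply when the first component is itself a sequence, as with
`push`. -/
theorem assoc (h : Halts (P ;; P' ;; Q) s T R) : Halts ((P ;; P') ;; Q) s T R := by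
  obtain ⟨t, s', ht, hrun, hs'⟩ := h
  cases hrun with
  | seq h1 h2 =>
    cases h2 with
    | seq h2 h3 => exact ⟨_, s', by omega, .seq (.seq h1 h2) h3, hs'⟩

theorem const (h : R (s.setReg x c)) : Halts (.const x c) s (T + 1) R :=
  ⟨1, _, by omega, .const _ _ _, h⟩

theorem add (h : R (s.setReg x (s.reg y + s.reg z))) : Halts (.add x y z) s (T + 1) R :=
  ⟨1, _, by omega, .add _ _ _ _, h⟩

theorem sub (h : R (s.setReg x (s.reg y - s.reg z))) : Halts (.sub x y z) s (T + 1) R :=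
  ⟨1, _, by omega, .sub _ _ _ _, h⟩

theorem read (h : R (s.setReg x (s.arr A (s.reg i)))) : Halts (.read x A i) s (T + 1) R :=
  ⟨1, _, by omega, .read _ _ _ _, h⟩

theorem write (h : R (s.setArr A (s.reg i) (s.reg x))) : Halts (.write A i x) s (T + 1) R :=
  ⟨1, _, by omega, .write _ _ _ _, h⟩

theorem step_seq {s' : State} (hrun : Run P s 1 s') (h : Halts Q s' T R) :
    Halts (P ;; Q) s (T + 1) R := by
  obtain ⟨t, s'', ht, hrun', hs'⟩ := h
  exact ⟨1 + t, s'', by omega, .seq hrun hrun', hs'⟩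

theorem const_seq (h : Halts Q (s.setReg x c) T R) : Halts (.const x c ;; Q) s (T + 1) R :=
  step_seq (.const _ _ _) h

theorem add_seq (h : Halts Q (s.setReg x (s.reg y + s.reg z)) T R) :
    Halts (.add x y z ;; Q) s (T + 1) R :=
  step_seq (.add _ _ _ _) h

theorem sub_seq (h : Halts Q (s.setReg x (s.reg y - s.reg z)) T R) :
    Halts (.sub x y z ;; Q) s (T + 1) R :=
  step_seq (.sub _ _ _ _) h

theorem read_seq (h : Halts Q (s.setReg x (s.arr A (s.reg i))) T R) :
    Halts (.read x A i ;; Q) s (T + 1) R :=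
  step_seq (.read _ _ _ _) h

theorem write_seq (h : Halts Q (s.setArr A (s.reg i) (s.reg x)) T R) :
    Halts (.write A i x ;; Q) s (T + 1) R :=
  step_seq (.write _ _ _ _) h

/-- The continuation is analyzed inside each branch, which avoids stating a postcondition where the
branches join. -/
theorem ite_seq (h : s.reg x ≠ 0 → Halts (P ;; Q) s T R)
    (h' : s.reg x = 0 → Halts (P' ;; Q) s T R) : Halts (.ite x P P' ;; Q) s (T + 1) R := by
  by_cases hx : s.reg x = 0
  · obtain ⟨t, s', ht, hrun, hs'⟩ := h' hx
    cases hrun with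
    | seq h1 h2 => exact ⟨_, s', by omega, .seq (.ite_false hx h1) h2, hs'⟩
  · obtain ⟨t, s', ht, hrun, hs'⟩ := h hx
    cases hrun with
    | seq h1 h2 => exact ⟨_, s', by omega, .seq (.ite_true hx h1) h2, hs'⟩

/-- A loop running through `n` rounds. -/
theorem loop (n : ℕ) (Inv : ℕ → State → Prop) (h0 : Inv 0 s)
    (hstep : ∀ i s, i < n → Inv i s → s.reg x ≠ 0 ∧ Halts P s T (Inv (i + 1)))
    (hend : ∀ s, Inv n s → s.reg x = 0) : Halts (.loop x P) s (n * (T + 1) + 1) (Inv n) := by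
  have key : ∀ m i s, i + m = n → Inv i s → Halts (.loop x P) s (m * (T + 1) + 1) (Inv n) := by
    intro m
    induction m with
    | zero =>
      rintro i s rfl h
      exact ⟨1, s, by omega, by constructor; exact hend s h, h⟩
    | succ m ih =>
      intro i s hi h
      obtain ⟨hx, t, s', ht, hrun, hs'⟩ := hstep i s (by omega) h
      obtain ⟨t', s'', ht', hrun', hs''⟩ := ih (i + 1) s' (by omega) hs'
      refine ⟨t + t' + 1, s'', ?_, .loop_step hx hrun hrun', hs''⟩
      rw [add_mul]
      omega
  exact key n 0 s (by omega) h0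

end Halts

/-- The programs `f 0`, …, `f (n - 1)`, one after the other. -/
def seqRange (f : ℕ → Prog) : ℕ → Prog
  -- Register `40` is never read, so this assignment is a no-op.
  | 0 => .const 40 0
  | n + 1 => seqRange f n ;; f n

theorem Halts.seqRange {f : ℕ → Prog} {s : State} {T : ℕ} (n : ℕ) (Inv : ℕ → State → Prop)
    (h0 : Inv 0 (s.setReg 40 0))
    (hstep : ∀ i s, i < n → Inv i s → Halts (f i) s T (Inv (i + 1))) :
    Halts (seqRange f n) s (n * T + 1) (Inv n) := by
  induction n with
  | zero => exact (Halts.const (T := 0) h0).mono (by omega) fun _ h => h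
  | succ n ih =>
    refine ((ih fun i s hi => hstep i s (by omega)).seq fun s' h' =>
      hstep n s' (by omega) h').mono ?_ fun _ h => h
    rw [add_mul]
    omega

/-- Each matrix cell has a unique row and column, by division with remainder by `n`. -/
theorem adjArray_eq {n : ℕ} (G : SimpleGraph (Fin n)) [DecidableRel G.Adj] (u v : Fin n) :
    adjArray G (n * u.val + v.val) = if G.Adj u v then 1 else 0 := by
  have h : (∃ u' v' : Fin n, G.Adj u' v' ∧ n * u.val + v.val = n * u'.val + v'.val) ↔
      G.Adj u v := by
    constructor
    · rintro ⟨u', v', h, e⟩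
      have hn : 0 < n := by have := u.isLt; omega
      have hu : u = u' := by
        have := congrArg (· / n) e
        simp only [Nat.mul_add_div hn, Nat.div_eq_of_lt v.isLt,
          Nat.div_eq_of_lt v'.isLt, add_zero] at this
        exact Fin.ext this
      subst hu
      obtain rfl : v = v' := Fin.ext (by omega)
      exact h
    · intro h
      exact ⟨u, v, h, rfl⟩
  simp only [adjArray, h]

end RAM

/-! ### A program computing the encoding -/

namespace Encoding

open RAM

variable {n T r : ℕ} {H : SimpleGraph (Fin n)}

/-- The numbering of the blocks. -/
def blockEquiv (n T : ℕ) : Block n T ≃ Fin (n * (n + 6) + T) :=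
  (Equiv.sumCongr (((Equiv.refl _).prodCongr finSumFinEquiv).trans finProdFinEquiv)
    (Equiv.refl _)).trans finSumFinEquiv

/-- The number of a block. -/
def idx (b : Block n T) : ℕ := (blockEquiv n T b).val

@[simp] theorem idx_edge (u v : Fin n) :
    idx (.inl (u, .inl v) : Block n T) = v.val + (n + 6) * u.val := by
  simp [idx, blockEquiv]

@[simp] theorem idx_slot (u : Fin n) (j : Fin 6) :
    idx (.inl (u, .inr j) : Block n T) = n + j.val + (n + 6) * u.val := by
  simp [idx, blockEquiv]

@[simp] theorem idx_free (t : Fin T) : idx (.inr t : Block n T) = n * (n + 6) + t.val := by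
  simp [idx, blockEquiv]

theorem idx_inj {b c : Block n T} (h : idx b = idx c) : b = c :=
  (blockEquiv n T).injective (Fin.ext h)

theorem idx_lt (b : Block n T) : idx b < n * (n + 6) + T := (blockEquiv n T b).isLt

/-- The state while the table of blocks is being filled. Register `0` holds `n`, register `2` holds
one, register `4` the number of blocks per vertex, register `5` the number of blocks written so far,
register `15` zero; arrays `2` and `3` hold the representatives of the blocks. -/
structure Table (H : SimpleGraph (Fin n)) (T : ℕ) (s : State) (p : ℕ) : Prop where
  reg0 : s.reg 0 = n
  reg2 : s.reg 2 = 1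
  reg4 : s.reg 4 = n + 6
  reg5 : s.reg 5 = p
  reg15 : s.reg 15 = 0
  arr0 : ∀ u v : Fin n, s.arr 0 (n * u.val + v.val) = 0 ↔ ¬ H.Adj u v
  arr2 : ∀ b : Block n T, idx b < p → s.arr 2 (idx b) = idx (first b)
  arr3 : ∀ b : Block n T, idx b < p → s.arr 3 (idx b) = idx (last H b)

/-- Append a block whose representatives are in the registers `i` and `j`. -/
def push (i j : ℕ) : Prog := .write 2 5 i ;; .write 3 5 j ;; .add 5 5 2

/-- The state after `push`. -/
def pushed (s : State) (i j : ℕ) : State :=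
  ((s.setArr 2 (s.reg 5) (s.reg i)).setArr 3 (s.reg 5) (s.reg j)).setReg 5 (s.reg 5 + s.reg 2)

theorem push_seq {Q : Prog} {s : State} {t i j : ℕ} {R : State → Prop}
    (h : Halts Q (pushed s i j) t R) : Halts (push i j ;; Q) s (t + 3) R :=
  .assoc (.write_seq (.assoc (.write_seq (.add_seq h))))

theorem pushed_reg {s : State} {i j y : ℕ} (hy : y ≠ 5) : (pushed s i j).reg y = s.reg y := by
  simp [pushed, hy]

theorem Table.setReg {s : State} {p x a : ℕ} (h : Table H T s p)
    (hx : x ≠ 0 ∧ x ≠ 2 ∧ x ≠ 4 ∧ x ≠ 5 ∧ x ≠ 15) : Table H T (s.setReg x a) p := by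
  obtain ⟨h0, h2, h4, h5, h15⟩ := hx
  exact ⟨by simp [h0.symm, h.reg0], by simp [h2.symm, h.reg2], by simp [h4.symm, h.reg4],
    by simp [h5.symm, h.reg5], by simp [h15.symm, h.reg15], h.arr0, h.arr2, h.arr3⟩

theorem Table.pushed {s : State} {i j p : ℕ} (h : Table H T s p) (b : Block n T) (hp : p = idx b)
    (hi : s.reg i = idx (first b)) (hj : s.reg j = idx (last H b)) :
    Table H T (pushed s i j) (p + 1) := by
  subst hp
  have key : ∀ c : Block n T, idx c < idx b + 1 → idx c ≠ idx b → idx c < idx b := by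
    intro c h h'; omega
  constructor
  · rw [pushed_reg (by decide), h.reg0]
  · rw [pushed_reg (by decide), h.reg2]
  · rw [pushed_reg (by decide), h.reg4]
  · simp [Encoding.pushed, h.reg5, h.reg2]
  · rw [pushed_reg (by decide), h.reg15]
  · intro u v
    simp [Encoding.pushed, h.arr0]
  · intro c hc
    by_cases e : idx c = idx b
    · obtain rfl := idx_inj e
      simp [Encoding.pushed, h.reg5, hi]
    · simp [Encoding.pushed, h.reg5, e, h.arr2 c (key c hc e)]
  · intro c hc
    by_cases e : idx c = idx b
    · obtain rfl := idx_inj e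
      simp [Encoding.pushed, h.reg5, hj]
    · simp [Encoding.pushed, h.reg5, e, h.arr3 c (key c hc e)]

/-- Append the block for the pair `(u, v)`. -/
def edgeStep : Prog :=
  -- Adding the zero register `15` copies. Register `12` is the truncated `u - v`, so both tests
  -- pass exactly when `v < u` and `uv` is an edge; register `11` is the number of block `(v, u)`.
  .read 13 0 9 ;; .add 14 5 15 ;;
  .ite 12 (.ite 13 (.add 14 11 15) (.const 40 0)) (.const 40 0) ;;
  push 8 14 ;; .add 9 9 2 ;; .add 11 11 4 ;; .sub 12 12 2 ;; .sub 10 10 2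

/-- The registers used while the blocks of the vertex `u` are appended. -/
structure RowRegs (n u : ℕ) (s : State) : Prop where
  reg6 : s.reg 6 = n - u
  reg7 : s.reg 7 = u
  reg8 : s.reg 8 = n + (n + 6) * u

/-- The registers used while the block of the pair `(u, v)` is appended. -/
structure EdgeRegs (n u v : ℕ) (s : State) : Prop where
  reg9 : s.reg 9 = n * u + v
  reg10 : s.reg 10 = n - v
  reg11 : s.reg 11 = u + (n + 6) * v
  reg12 : s.reg 12 = u - v

theorem edgeStep_halts {s : State} (u v : Fin n)
    (h : Table H T s (v.val + (n + 6) * u.val)) (hr : RowRegs n u s) (he : EdgeRegs n u v s) :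
    Halts edgeStep s 13 fun s' => Table H T s' (v.val + 1 + (n + 6) * u.val) ∧ RowRegs n u s' ∧
      EdgeRegs n u (v.val + 1) s' := by
  have fin : ∀ s : State, Table H T s (v.val + (n + 6) * u.val) → RowRegs n u s →
      EdgeRegs n u v s → s.reg 14 = idx (last (T := T) H (.inl (u, .inl v))) →
      Halts (push 8 14 ;; .add 9 9 2 ;; .add 11 11 4 ;; .sub 12 12 2 ;; .sub 10 10 2) s 8
      fun s' => Table H T s' (v.val + 1 + (n + 6) * u.val) ∧ RowRegs n u s' ∧
      EdgeRegs n u (v.val + 1) s' := by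
    intro s h hr he h14
    have hp := h.pushed (i := 8) (j := 14) (.inl (u, .inl v)) (by simp)
      (by simp [hr.reg8, first]) h14
    refine push_seq (.add_seq (.add_seq (.sub_seq (.sub ⟨?_, ⟨?_, ?_, ?_⟩, ⟨?_, ?_, ?_, ?_⟩⟩))))
    · rw [add_right_comm]
      exact (((hp.setReg (by decide)).setReg (by decide)).setReg (by decide)).setReg (by decide)
    all_goals simp only [State.reg_setReg, pushed_reg, ne_eq, Nat.reduceEqDiff,
      not_false_eq_true, if_true, if_false, h.reg2, h.reg4, hr.reg6, hr.reg7, hr.reg8, he.reg9,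
      he.reg10, he.reg11, he.reg12]
    · ring
    · omega
    · ring
    · omega
  have h13 : s.arr 0 (s.reg 9) = 0 ↔ ¬ H.Adj u v := by rw [he.reg9]; exact h.arr0 u v
  have hT1 : ∀ a b, Table H T ((s.setReg 13 a).setReg 14 b) (v.val + (n + 6) * u.val) := fun a b =>
    (h.setReg (by decide)).setReg (by decide)
  have hrow : ∀ (s : State) x a, RowRegs n u s → 12 < x → RowRegs n u (s.setReg x a) := by
    intro s x a h hx
    have h6 : ¬ 6 = x := by omega
    have h7 : ¬ 7 = x := by omega
    have h8 : ¬ 8 = x := by omega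
    exact ⟨by simp [h6, h.reg6], by simp [h7, h.reg7], by simp [h8, h.reg8]⟩
  have hedge : ∀ (s : State) x a, EdgeRegs n u v s → 12 < x → EdgeRegs n u v (s.setReg x a) := by
    intro s x a h hx
    have h9 : ¬ 9 = x := by omega
    have h10 : ¬ 10 = x := by omega
    have h11 : ¬ 11 = x := by omega
    have h12 : ¬ 12 = x := by omega
    exact ⟨by simp [h9, h.reg9], by simp [h10, h.reg10], by simp [h11, h.reg11],
      by simp [h12, h.reg12]⟩
  have hlt : s.reg 12 = 0 ↔ ¬ v < u := by
    rw [he.reg12, Fin.lt_def]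
    omega
  refine .read_seq (.add_seq (.ite_seq (fun h12 => ?_) fun h12 => ?_))
  · have h12 : v < u := by
      simp only [State.reg_setReg, Nat.reduceEqDiff, if_false] at h12
      rw [ne_eq, hlt, not_not] at h12
      exact h12
    refine .ite_seq (fun h13' => ?_) fun h13' => ?_
    · have hA : H.Adj u v := by
        simp only [State.reg_setReg, Nat.reduceEqDiff, if_false, if_true]
          at h13'
        rw [ne_eq, h13, not_not] at h13'
        exact h13'
      refine .add_seq (fin _ ((hT1 _ _).setReg (by decide)) ?_ ?_ ?_)
      · exact hrow _ _ _ (hrow _ _ _ (hrow _ _ _ hr (by decide)) (by decide)) (by decide)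
      · exact hedge _ _ _ (hedge _ _ _ (hedge _ _ _ he (by decide)) (by decide)) (by decide)
      · simp [last, hA, h12, he.reg11, h.reg15]
    · have hA : ¬ H.Adj u v := by
        simp only [State.reg_setReg, Nat.reduceEqDiff, if_false, if_true]
          at h13'
        exact h13.1 h13'
      refine .const_seq (fin _ ((hT1 _ _).setReg (by decide)) ?_ ?_ ?_)
      · exact hrow _ _ _ (hrow _ _ _ (hrow _ _ _ hr (by decide)) (by decide)) (by decide)
      · exact hedge _ _ _ (hedge _ _ _ (hedge _ _ _ he (by decide)) (by decide)) (by decide)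
      · simp [last, hA, h.reg5, h.reg15]
  · have h12 : ¬ v < u := by
      simp only [State.reg_setReg, Nat.reduceEqDiff, if_false] at h12
      exact hlt.1 h12
    -- This branch skips the inner test, so its time bound is padded to that of the other branch.
    refine Halts.mono (T := 10) (.const_seq (T := 9) (Halts.mono (fin _ ((hT1 _ _).setReg
      (by decide)) ?_ ?_ ?_) (by omega) fun _ h => h)) (by omega) fun _ h => h
    · exact hrow _ _ _ (hrow _ _ _ (hrow _ _ _ hr (by decide)) (by decide)) (by decide)
    · exact hedge _ _ _ (hedge _ _ _ (hedge _ _ _ he (by decide)) (by decide)) (by decide)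
    · simp [last, h12, h.reg5, h.reg15]

end Encoding

/-! ### Filling the table of representatives -/

namespace Encoding

open RAM

variable {n T r : ℕ} {H : SimpleGraph (Fin n)}

/-- Append all blocks of a vertex. -/
def rowStep : Prog :=
  .add 10 0 15 ;; .add 11 7 15 ;; .add 12 7 15 ;; .loop 10 edgeStep ;;
  -- Register `8` is the number of slot `0`, register `5` that of the block being appended: slots
  -- `1` to `3` join slot `0` in the first layer, slots `4` and `5` in the last.
  push 8 8 ;; push 8 5 ;; push 8 5 ;; push 8 5 ;; push 5 8 ;; push 5 8 ;;
  .add 7 7 2 ;; .add 8 8 4 ;; .sub 6 6 2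

theorem rowStep_halts {s : State} (u : Fin n) (h : Table H T s ((n + 6) * u.val))
    (hr : RowRegs n u s) (h9 : s.reg 9 = n * u.val) :
    Halts rowStep s (14 * n + 25) fun s' => Table H T s' ((n + 6) * (u.val + 1)) ∧
      RowRegs n (u.val + 1) s' ∧ s'.reg 9 = n * (u.val + 1) := by
  refine Halts.mono (T := ((n * 14 + 1) + 21) + 3) ?_ (by omega) fun _ h => h
  refine .add_seq (.add_seq (.add_seq (Halts.seq (T := n * (13 + 1) + 1) (T' := 21)
    (Halts.loop n (fun v s' =>
    Table H T s' (v + (n + 6) * u.val) ∧ RowRegs n u s' ∧ EdgeRegs n u v s') ?_ ?_ ?_) ?_)))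
  · refine ⟨?_, ⟨?_, ?_, ?_⟩, ⟨?_, ?_, ?_, ?_⟩⟩
    · rw [zero_add]
      exact ((h.setReg (by decide)).setReg (by decide)).setReg (by decide)
    all_goals simp [h.reg0, h.reg15, hr.reg6, hr.reg7, hr.reg8, h9]
  · rintro v s hv ⟨h1, h2, h3⟩
    refine ⟨?_, edgeStep_halts u ⟨v, hv⟩ h1 h2 h3⟩
    rw [h3.reg10]
    omega
  · rintro s ⟨-, -, h3⟩
    rw [h3.reg10]
    omega
  · rintro s ⟨h, hr, he⟩
    have h8 := hr.reg8
    have p0 := h.pushed (i := 8) (j := 8) (.inl (u, .inr 0)) (by simp)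
      (by simp [h8, first]) (by simp [h8, last])
    have p1 := p0.pushed (i := 8) (j := 5) (.inl (u, .inr 1)) (by simp; omega)
      (by rw [pushed_reg (by decide)]; simp [h8, first]) (by simp [p0.reg5, last]; omega)
    have p2 := p1.pushed (i := 8) (j := 5) (.inl (u, .inr 2)) (by simp; omega)
      (by simp only [pushed_reg, ne_eq, Nat.reduceEqDiff, not_false_eq_true]; simp [h8, first])
      (by simp [p1.reg5, last]; omega)
    have p3 := p2.pushed (i := 8) (j := 5) (.inl (u, .inr 3)) (by simp; omega)
      (by simp only [pushed_reg, ne_eq, Nat.reduceEqDiff, not_false_eq_true]; simp [h8, first])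
      (by simp [p2.reg5, last]; omega)
    have p4 := p3.pushed (i := 5) (j := 8) (.inl (u, .inr 4)) (by simp; omega)
      (by simp [p3.reg5, first]; omega)
      (by simp only [pushed_reg, ne_eq, Nat.reduceEqDiff, not_false_eq_true]; simp [h8, last])
    have p5 := p4.pushed (i := 5) (j := 8) (.inl (u, .inr 5)) (by simp; omega)
      (by simp [p4.reg5, first]; omega)
      (by simp only [pushed_reg, ne_eq, Nat.reduceEqDiff, not_false_eq_true]; simp [h8, last])
    refine push_seq (push_seq (push_seq (push_seq (push_seq (push_seq (.add_seq (.add_seq (.sub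
      ⟨?_, ⟨?_, ?_, ?_⟩, ?_⟩))))))))
    · have e : (n + 6) * (u.val + 1) = n + (n + 6) * u.val + 1 + 1 + 1 + 1 + 1 + 1 := by ring
      rw [e]
      exact ((p5.setReg (by decide)).setReg (by decide)).setReg (by decide)
    all_goals simp only [State.reg_setReg, pushed_reg, ne_eq, Nat.reduceEqDiff,
      not_false_eq_true, if_true, if_false, h.reg2, h.reg4, hr.reg6, hr.reg7, hr.reg8, he.reg9]
    · omega
    · ring
    · ring

/-- The program filling the table of blocks. -/
def tableProg (T : ℕ) : Prog :=
  .const 2 1 ;; .const 3 6 ;; .add 4 0 3 ;; .add 6 0 15 ;; .add 8 0 15 ;; .loop 6 rowStep ;;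
  .const 6 T ;; .loop 6 (push 5 5 ;; .sub 6 6 2)

theorem tableProg_halts (H : SimpleGraph (Fin n)) (T : ℕ) :
    Halts (tableProg T) (input H) (n * (14 * n + 26) + T * 5 + 8) fun s =>
      Table H T s (n * (n + 6) + T) := by
  classical
  refine Halts.mono (T := ((n * (14 * n + 25 + 1) + 1) + ((T * 5 + 1) + 1)) + 5) ?_
    (by rw [add_assoc (14 * n)]; omega)
    fun _ h => h
  refine .const_seq (.const_seq (.add_seq (.add_seq (.add_seq (Halts.seq (T := n * (14 * n + 25 + 1) + 1)
    (T' := T * (4 + 1) + 1 + 1) (Halts.loop n (fun u s => Table H T s ((n + 6) * u) ∧ RowRegs n u s ∧ s.reg 9 = n * u) ?_ ?_ ?_) ?_)))))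
  · refine ⟨⟨?_, ?_, ?_, ?_, ?_, ?_, ?_, ?_⟩, ⟨?_, ?_, ?_⟩, ?_⟩
    · simp [input]
    · simp [input]
    · simp [input]
    · simp [input]
    · simp [input]
    · intro u v
      simp [input, adjArray_eq]
    · intro b hb
      simp at hb
    · intro b hb
      simp at hb
    all_goals simp [input]
  · rintro u s hu ⟨h1, h2, h3⟩
    refine ⟨?_, rowStep_halts ⟨u, hu⟩ h1 h2 h3⟩
    rw [h2.reg6]
    omega
  · rintro s ⟨-, h2, -⟩
    rw [h2.reg6]
    omega
  · rintro s ⟨h, -, -⟩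
    refine .const_seq (Halts.mono (T := T * (4 + 1) + 1) (Halts.loop T
      (fun i s => Table H T s (n * (n + 6) + i) ∧ s.reg 6 = T - i) ?_ ?_ ?_) le_rfl
      fun _ h => h.1)
    · rw [add_zero, mul_comm]
      exact ⟨h.setReg (by decide), by simp⟩
    · rintro i s hi ⟨h, h6⟩
      refine ⟨by omega, push_seq (.sub ⟨?_, ?_⟩)⟩
      · exact (h.pushed (.inr ⟨i, hi⟩) (by simp) (by simp [first, h.reg5])
          (by simp [last, h.reg5])).setReg (by decide)
      · simp only [State.reg_setReg, pushed_reg, ne_eq, Nat.reduceEqDiff, not_false_eq_true,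
          if_true, h6, h.reg2]
        omega
    · rintro s ⟨-, h6⟩
      omega

end Encoding

/-! ### Writing the adjacency matrix -/

namespace Encoding

open RAM BlockGraph

variable {n T r : ℕ} {S : Set (Sym2 (Fin r))} {H : SimpleGraph (Fin n)}

/-- The numbering of the vertices. -/
def vertexEquiv (n T r : ℕ) : Block n T × Fin r ≃ Fin ((n * (n + 6) + T) * r) :=
  ((blockEquiv n T).prodCongr (Equiv.refl _)).trans finProdFinEquiv

theorem vertexEquiv_val (b : Block n T) (l : Fin r) :
    (vertexEquiv n T r (b, l)).val = l.val + r * idx b := by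
  simp [vertexEquiv, idx]

/-- The encoding of `H`, on an initial segment of the natural numbers. -/
noncomputable def outGraph (T : ℕ) (S : Set (Sym2 (Fin r))) (H : SimpleGraph (Fin n)) :
    SimpleGraph (Fin ((n * (n + 6) + T) * r)) :=
  (graph T S H).comap (vertexEquiv n T r).symm

/-- The encoding of `H` is isomorphic to the block graph encoding `H`. -/
noncomputable def outIso (T : ℕ) (S : Set (Sym2 (Fin r))) (H : SimpleGraph (Fin n)) :
    graph T S H ≃g outGraph T S H :=
  ⟨vertexEquiv n T r, by intro u v; simp [outGraph]⟩

/-- Adjacency of vertices in the layers `l` and `l'`, depending on whether their blocks agree in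
the first layer and in the last layer. -/
def LayerAdj (S : Set (Sym2 (Fin r))) (l l' : ℕ) (e e' : Prop) : Prop :=
  ∃ (h : l < r) (h' : l' < r), ¬ (e ∧ e' ∧ l = l') ∧
    Xor ((e ∧ e' ∧ (l + 1 = l' ∨ l' + 1 = l)) ∨ (l = 0 ∧ l' = 0 ∧ e) ∨
      (l + 1 = r ∧ l' + 1 = r ∧ e')) (s(⟨l, h⟩, ⟨l', h'⟩) ∈ S)

/-- Blocks are equal exactly when both representatives agree, so two equality tests per pair of
blocks determine all entries for that pair. -/
theorem graph_adj_iff (b b' : Block n T) (l l' : Fin r) :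
    (graph T S H).Adj (b, l) (b', l') ↔
      LayerAdj S l l' (first b = first b') (last H b = last H b') := by
  have hb : b = b' ↔ first b = first b' ∧ last H b = last H b' :=
    ⟨fun h => by simp [h], fun h => eq_of_first_eq_of_last_eq h.1 h.2⟩
  simp only [adj_iff, BlockLink, LayerAdj, l.isLt, l'.isLt, exists_true_left, Fin.eta, ne_eq,
    Prod.mk.injEq, hb, and_assoc, Fin.ext_iff]

open Classical in
theorem adjArray_outGraph (b b' : Block n T) (l l' : Fin r) :
    adjArray (outGraph T S H) ((n * (n + 6) + T) * r * (l + r * idx b) + (l' + r * idx b')) =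
      if LayerAdj S l l' (first b = first b') (last H b = last H b') then 1 else 0 := by
  rw [← vertexEquiv_val, ← vertexEquiv_val, adjArray_eq, ← graph_adj_iff (H := H)]
  simp [outGraph]

/-- The state while the adjacency matrix is being written; register `18` holds the number of entries
written so far. -/
structure Matrix (S : Set (Sym2 (Fin r))) (H : SimpleGraph (Fin n)) (T : ℕ) (s : State) (p : ℕ) :
    Prop where
  reg1 : s.reg 1 = (n * (n + 6) + T) * r
  reg2 : s.reg 2 = 1
  reg5 : s.reg 5 = n * (n + 6) + T
  reg15 : s.reg 15 = 0
  reg18 : s.reg 18 = p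
  arr1 : ∀ a < p, s.arr 1 a = adjArray (outGraph T S H) a
  arr2 : ∀ b : Block n T, s.arr 2 (idx b) = idx (first b)
  arr3 : ∀ b : Block n T, s.arr 3 (idx b) = idx (last H b)

theorem Matrix.setReg {s : State} {p x a : ℕ} (h : Matrix S H T s p)
    (hx : x ≠ 1 ∧ x ≠ 2 ∧ x ≠ 5 ∧ x ≠ 15 ∧ x ≠ 18) : Matrix S H T (s.setReg x a) p := by
  obtain ⟨h1, h2, h5, h15, h18⟩ := hx
  exact ⟨by simp [h1.symm, h.reg1], by simp [h2.symm, h.reg2], by simp [h5.symm, h.reg5],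
    by simp [h15.symm, h.reg15], by simp [h18.symm, h.reg18], h.arr1, h.arr2, h.arr3⟩

open Classical in
/-- Write the next entry, for vertices in the layers `l` and `l'`. -/
noncomputable def emit (S : Set (Sym2 (Fin r))) (l l' : ℕ) : Prog :=
  -- Nonzero registers `25` and `26` mean different representatives. The constants depend only on
  -- `S` and the layers and are fixed in the program text.
  .ite 25
    (.ite 26 (.const 28 (if LayerAdj S l l' False False then 1 else 0))
      (.const 28 (if LayerAdj S l l' False True then 1 else 0)))
    (.ite 26 (.const 28 (if LayerAdj S l l' True False then 1 else 0))
      (.const 28 (if LayerAdj S l l' True True then 1 else 0))) ;;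
  .write 1 18 28 ;; .add 18 18 2

/-- The registers describing the first block. -/
structure LeftRegs (H : SimpleGraph (Fin n)) (b : Block n T) (s : State) : Prop where
  reg16 : s.reg 16 = n * (n + 6) + T - idx b
  reg17 : s.reg 17 = idx b
  reg19 : s.reg 19 = idx (first b)
  reg20 : s.reg 20 = idx (last H b)

/-- The registers describing the second block. -/
structure RightRegs (H : SimpleGraph (Fin n)) (b b' : Block n T) (s : State) : Prop where
  reg21 : s.reg 21 = n * (n + 6) + T - idx b'
  reg22 : s.reg 22 = idx b'
  reg25 : s.reg 25 = 0 ↔ first b = first b'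
  reg26 : s.reg 26 = 0 ↔ last H b = last H b'

theorem LeftRegs.congr {b : Block n T} {s s' : State} (h : LeftRegs H b s)
    (hs : ∀ y, 16 ≤ y → y ≤ 20 → y ≠ 18 → s'.reg y = s.reg y) : LeftRegs H b s' := by
  constructor
  · rw [hs _ (by decide) (by decide) (by decide), h.reg16]
  · rw [hs _ (by decide) (by decide) (by decide), h.reg17]
  · rw [hs _ (by decide) (by decide) (by decide), h.reg19]
  · rw [hs _ (by decide) (by decide) (by decide), h.reg20]

theorem RightRegs.congr {b b' : Block n T} {s s' : State} (h : RightRegs H b b' s)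
    (hs : ∀ y, 21 ≤ y → y ≤ 26 → s'.reg y = s.reg y) : RightRegs H b b' s' := by
  constructor
  · rw [hs _ (by decide) (by decide), h.reg21]
  · rw [hs _ (by decide) (by decide), h.reg22]
  · rw [hs _ (by decide) (by decide), h.reg25]
  · rw [hs _ (by decide) (by decide), h.reg26]

theorem emit_halts {s : State} (b b' : Block n T) (l l' : Fin r)
    (h : Matrix S H T s ((n * (n + 6) + T) * r * (l + r * idx b) + (l' + r * idx b')))
    (hl : LeftRegs H b s) (hr : RightRegs H b b' s) :
    Halts (emit S l l') s 5 fun s' => Matrix S H T s'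
      ((n * (n + 6) + T) * r * (l + r * idx b) + (l'.val + 1 + r * idx b')) ∧
      LeftRegs H b s' ∧ RightRegs H b b' s' := by
  classical
  have fin : ∀ c, c = adjArray (outGraph T S H)
      ((n * (n + 6) + T) * r * (l + r * idx b) + (l' + r * idx b')) →
      Halts (.const 28 c ;; .write 1 18 28 ;; .add 18 18 2) s 3 fun s' => Matrix S H T s'
      ((n * (n + 6) + T) * r * (l + r * idx b) + (l'.val + 1 + r * idx b')) ∧
      LeftRegs H b s' ∧ RightRegs H b b' s' := by
    rintro c rfl
    refine .const_seq (.write_seq (.add ⟨⟨?_, ?_, ?_, ?_, ?_, ?_, ?_, ?_⟩, ?_, ?_⟩))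
    · simp [h.reg1]
    · simp [h.reg2]
    · simp [h.reg5]
    · simp [h.reg15]
    · simp [h.reg18, h.reg2]
      omega
    · intro a ha
      simp only [State.arr_setReg, State.arr_setArr, State.reg_setReg, Nat.reduceEqDiff, if_false,
        true_and, h.reg18, if_true]
      split_ifs with e
      · rw [e]
      · exact h.arr1 a (by omega)
    · simp [h.arr2]
    · simp [h.arr3]
    · refine hl.congr fun y h1 h2 h3 => ?_
      have : y ≠ 28 := by omega
      simp [h3, this]
    · refine hr.congr fun y h1 h2 => ?_
      have h3 : y ≠ 28 := by omega
      have h4 : y ≠ 18 := by omega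
      simp [h3, h4]
  have hadj := adjArray_outGraph (S := S) (H := H) b b' l l'
  refine .ite_seq (fun h25 => .ite_seq (fun h26 => fin _ ?_) fun h26 => fin _ ?_) fun h25 =>
    .ite_seq (fun h26 => fin _ ?_) fun h26 => fin _ ?_
  all_goals
    rw [hadj]
    simp only [hr.reg25, hr.reg26, ne_eq] at h25 h26
    simp only [h25, h26]

/-- Write the entries for vertices of two given blocks, the first of them in layer `l`. -/
noncomputable def pairStep (S : Set (Sym2 (Fin r))) (l : ℕ) : Prog :=
  -- The sum of the truncated differences in both directions vanishes exactly when two numbers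
  -- agree.
  .read 23 2 22 ;; .read 24 3 22 ;; .sub 25 19 23 ;; .sub 27 23 19 ;; .add 25 25 27 ;;
  .sub 26 20 24 ;; .sub 27 24 20 ;; .add 26 26 27 ;; seqRange (emit S l) r ;;
  .add 22 22 2 ;; .sub 21 21 2

theorem pairStep_halts {s : State} (b b' : Block n T) (l : Fin r)
    (h : Matrix S H T s ((n * (n + 6) + T) * r * (l + r * idx b) + r * idx b'))
    (hl : LeftRegs H b s) (h21 : s.reg 21 = n * (n + 6) + T - idx b') (h22 : s.reg 22 = idx b') :
    Halts (pairStep S l) s (r * 5 + 11) fun s' => Matrix S H T s'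
      ((n * (n + 6) + T) * r * (l + r * idx b) + r * (idx b' + 1)) ∧
      LeftRegs H b s' ∧ s'.reg 21 = n * (n + 6) + T - (idx b' + 1) ∧ s'.reg 22 = idx b' + 1 := by
  have hdist : ∀ c c' : Block n T, idx c - idx c' + (idx c' - idx c) = 0 ↔ c = c' := by
    intro c c'
    constructor
    · intro h
      exact idx_inj (by omega)
    · rintro rfl
      simp
  refine Halts.mono (T := ((r * 5 + 1) + (1 + 1)) + 8) ?_ (by omega) fun _ h => h
  refine .read_seq (.read_seq (.sub_seq (.sub_seq (.add_seq (.sub_seq (.sub_seq (.add_seq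
    (Halts.seq (T := r * 5 + 1) (T' := 1 + 1) (Halts.seqRange r (fun i s' => Matrix S H T s'
      ((n * (n + 6) + T) * r * (l + r * idx b) + (i + r * idx b')) ∧
      LeftRegs H b s' ∧ RightRegs H b b' s') ?_ ?_) ?_))))))))
  · refine ⟨?_, ?_, ?_⟩
    · rw [zero_add]
      iterate 9 refine Matrix.setReg ?_ (by decide)
      exact h
    · refine hl.congr fun y h1 h2 h3 => ?_
      have h23 : y ≠ 23 := by omega
      have h24 : y ≠ 24 := by omega
      have h25 : y ≠ 25 := by omega
      have h26 : y ≠ 26 := by omega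
      have h27 : y ≠ 27 := by omega
      have h40 : y ≠ 40 := by omega
      simp [h23, h24, h25, h26, h27, h40]
    · constructor
      · simp [h21]
      · simp [h22]
      · rw [← hdist (first b) (first b')]
        simp [hl.reg19, h22, h.arr2]
      · rw [← hdist (last H b) (last H b')]
        simp [hl.reg20, h22, h.arr3]
  · rintro i s hi ⟨h1, h2, h3⟩
    exact emit_halts b b' l ⟨i, hi⟩ h1 h2 h3
  · rintro s ⟨h1, h2, h3⟩
    refine .add_seq (.sub ⟨?_, ?_, ?_, ?_⟩)
    · have e : r * (idx b' + 1) = r + r * idx b' := by ring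
      rw [e]
      exact (h1.setReg (by decide)).setReg (by decide)
    · refine h2.congr fun y h1 h2 h3 => ?_
      have h21 : y ≠ 21 := by omega
      have h22 : y ≠ 22 := by omega
      simp [h21, h22]
    · simp [h3.reg21, h1.reg2]
      omega
    · simp [h3.reg22, h1.reg2]

/-- Write the row of the vertex of a given block in layer `l`. -/
noncomputable def lineStep (S : Set (Sym2 (Fin r))) (l : ℕ) : Prog :=
  .add 21 5 15 ;; .const 22 0 ;; .loop 21 (pairStep S l)

theorem exists_idx_eq {k : ℕ} (hk : k < n * (n + 6) + T) : ∃ b : Block n T, idx b = k :=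
  ⟨(blockEquiv n T).symm ⟨k, hk⟩, by simp [idx]⟩

theorem lineStep_halts {s : State} (b : Block n T) (l : Fin r)
    (h : Matrix S H T s ((n * (n + 6) + T) * r * (l + r * idx b))) (hl : LeftRegs H b s) :
    Halts (lineStep S l) s ((n * (n + 6) + T) * (r * 5 + 12) + 3) fun s' => Matrix S H T s'
      ((n * (n + 6) + T) * r * (l.val + 1 + r * idx b)) ∧ LeftRegs H b s' := by
  refine .add_seq (.const_seq (Halts.mono (Halts.loop (T := r * 5 + 11) (n * (n + 6) + T)
    (fun k s' => Matrix S H T s' ((n * (n + 6) + T) * r * (l + r * idx b) + r * k) ∧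
      LeftRegs H b s' ∧ s'.reg 21 = n * (n + 6) + T - k ∧ s'.reg 22 = k) ?_ ?_ ?_) le_rfl ?_))
  · refine ⟨?_, ?_, ?_, ?_⟩
    · rw [mul_zero, add_zero]
      exact (h.setReg (by decide)).setReg (by decide)
    · refine hl.congr fun y h1 h2 h3 => ?_
      have h21 : y ≠ 21 := by omega
      have h22 : y ≠ 22 := by omega
      simp [h21, h22]
    · simp [h.reg5, h.reg15]
    · simp
  · rintro k s hk ⟨h1, h2, h3, h4⟩
    obtain ⟨b', rfl⟩ := exists_idx_eq hk
    exact ⟨by omega, pairStep_halts b b' l h1 h2 h3 h4⟩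
  · rintro s ⟨-, -, h3, -⟩
    omega
  · rintro s ⟨h1, h2, -, -⟩
    refine ⟨?_, h2⟩
    have e : (n * (n + 6) + T) * r * (l.val + 1 + r * idx b) =
      (n * (n + 6) + T) * r * (l + r * idx b) + r * (n * (n + 6) + T) := by ring
    rw [e]
    exact h1

/-- Write the rows of the vertices of a given block. -/
noncomputable def blockStep (S : Set (Sym2 (Fin r))) : Prog :=
  .read 19 2 17 ;; .read 20 3 17 ;; seqRange (lineStep S) r ;; .add 17 17 2 ;; .sub 16 16 2

theorem blockStep_halts {s : State} (b : Block n T)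
    (h : Matrix S H T s ((n * (n + 6) + T) * r * (r * idx b)))
    (h16 : s.reg 16 = n * (n + 6) + T - idx b) (h17 : s.reg 17 = idx b) :
    Halts (blockStep S) s (r * ((n * (n + 6) + T) * (r * 5 + 12) + 3) + 1 + (1 + 1) + 2) fun s' =>
      Matrix S H T s' ((n * (n + 6) + T) * r * (r * (idx b + 1))) ∧
      s'.reg 16 = n * (n + 6) + T - (idx b + 1) ∧ s'.reg 17 = idx b + 1 := by
  refine .read_seq (.read_seq (Halts.seq
    (T := r * ((n * (n + 6) + T) * (r * 5 + 12) + 3) + 1) (T' := 1 + 1)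
    (Halts.seqRange r (fun i s' => Matrix S H T s'
      ((n * (n + 6) + T) * r * (i + r * idx b)) ∧ LeftRegs H b s') ?_ ?_) ?_))
  · refine ⟨?_, ⟨?_, ?_, ?_, ?_⟩⟩
    · rw [zero_add]
      exact ((h.setReg (by decide)).setReg (by decide)).setReg (by decide)
    · simp [h16]
    · simp [h17]
    · simp [h17, h.arr2]
    · simp [h17, h.arr3]
  · rintro i s hi ⟨h1, h2⟩
    exact lineStep_halts b ⟨i, hi⟩ h1 h2
  · rintro s ⟨h1, h2⟩
    refine .add_seq (.sub ⟨?_, ?_, ?_⟩)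
    · have e : r * (idx b + 1) = r + r * idx b := by ring
      rw [e]
      exact (h1.setReg (by decide)).setReg (by decide)
    · simp [h2.reg16, h1.reg2]
      omega
    · simp [h2.reg17, h1.reg2]

/-- Write the number of vertices and the adjacency matrix. -/
noncomputable def matrixProg (S : Set (Sym2 (Fin r))) : Prog :=
  .const 1 0 ;; seqRange (fun _ => .add 1 1 5) r ;;
  .const 18 0 ;; .const 17 0 ;; .add 16 5 15 ;; .loop 16 (blockStep S)

theorem matrixProg_halts {s : State} (h : Table H T s (n * (n + 6) + T)) :
    Halts (matrixProg S) s ((r * 1 + 1) + ((n * (n + 6) + T) *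
      ((r * ((n * (n + 6) + T) * (r * 5 + 12) + 3) + 1 + (1 + 1) + 2) + 1) + 1 + 3) + 1)
      fun s => Outputs s (outGraph T S H) := by
  -- In place of multiplication, the number of vertices is accumulated by `r` additions. Registers
  -- `1` and `18` do not have their proper values until later, so the invariant overrides them.
  refine .const_seq (Halts.seq (T := r * 1 + 1) (Halts.seqRange r (fun i s =>
    Matrix S H T (s.setReg 1 ((n * (n + 6) + T) * r) |>.setReg 18 0) 0 ∧
      s.reg 1 = (n * (n + 6) + T) * i) ?_ ?_) ?_)
  · refine ⟨⟨?_, ?_, ?_, ?_, ?_, ?_, ?_, ?_⟩, ?_⟩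
    · simp
    · simp [h.reg2]
    · simp [h.reg5]
    · simp [h.reg15]
    · simp
    · intro a ha
      omega
    · intro b
      simpa using h.arr2 b (idx_lt b)
    · intro b
      simpa using h.arr3 b (idx_lt b)
    · simp
  · rintro i s hi ⟨h1, h2⟩
    refine .add (T := 0) ⟨?_, ?_⟩
    · have e : ∀ a b c, ((s.setReg 1 a).setReg 1 b).setReg 18 c = (s.setReg 1 b).setReg 18 c := by
        intro a b c
        simp [State.setReg]
      rw [e]
      exact h1
    · have h5 : s.reg 5 = n * (n + 6) + T := by simpa using h1.reg5
      simp only [State.reg_setReg, if_true, h2, h5]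
      ring
  · rintro s ⟨h1, h2⟩
    refine .const_seq (.const_seq (.add_seq (Halts.mono (Halts.loop
      (T := r * ((n * (n + 6) + T) * (r * 5 + 12) + 3) + 1 + (1 + 1) + 2) (n * (n + 6) + T)
      (fun k s => Matrix S H T s ((n * (n + 6) + T) * r * (r * k)) ∧
        s.reg 16 = n * (n + 6) + T - k ∧ s.reg 17 = k) ?_ ?_ ?_) le_rfl ?_)))
    · have e : (s.setReg 1 ((n * (n + 6) + T) * r)).setReg 18 0 = s.setReg 18 0 := by
        rw [← h2]
        simp [State.setReg]
      rw [e] at h1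
      refine ⟨?_, ?_, ?_⟩
      · rw [mul_zero, mul_zero]
        exact (h1.setReg (by decide)).setReg (by decide)
      · have h5 := h1.reg5
        have h15 := h1.reg15
        simp only [State.reg_setReg, Nat.reduceEqDiff, if_false] at h5 h15
        simp [h5, h15]
      · simp
    · rintro k s hk ⟨h1, h2, h3⟩
      obtain ⟨b, rfl⟩ := exists_idx_eq hk
      exact ⟨by omega, blockStep_halts b h1 h2 h3⟩
    · rintro s ⟨-, h2, -⟩
      omega
    · rintro s ⟨h1, -, -⟩
      refine ⟨h1.reg1, fun a ha => h1.arr1 a ?_⟩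
      have e : (n * (n + 6) + T) * r * (r * (n * (n + 6) + T)) =
        (n * (n + 6) + T) * r * ((n * (n + 6) + T) * r) := by ring
      rw [e]
      exact ha

/-- The number of vertices is quadratic in `n` and each matrix entry costs boundedly many steps,
since `r`, `T` and `S` are wired into the program. -/
theorem exists_program (T : ℕ) (S : Set (Sym2 (Fin r))) :
    ∃ (P : Prog) (time : Polynomial ℕ), ∀ (n : ℕ) (H : SimpleGraph (Fin n)),
      Halts P (input H) (time.eval n) fun s => Outputs s (outGraph T S H) := by
  open Polynomial in
  refine ⟨tableProg T ;; matrixProg S, (X * (14 * X + 26) + C T * 5 + 8) +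
    ((C r * 1 + 1) + ((X * (X + 6) + C T) *
      ((C r * ((X * (X + 6) + C T) * (C r * 5 + 12) + 3) + 1 + (1 + 1) + 2) + 1) + 1 + 3) + 1),
    fun n H => ?_⟩
  refine ((tableProg_halts H T).seq fun s' h => matrixProg_halts (S := S) h).mono ?_ fun _ h => h
  simp

end Encoding

theorem mainTheorem8 (r k : ℕ) (hr : 3 ≤ r) (C : GraphClass) (hC : C.Hereditary)
    (hflip : ∀ n m : ℕ, ∃ G : SimpleGraph (BiwebVertex r n m),
      IsFlip k (biweb r n m) G ∧ C (BiwebVertex r n m) G) :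
    EffectivelyExistentiallyInterprets C allGraphs := by
  obtain ⟨S, hS⟩ := Biweb.exists_forall_containsBlockGraphs k C hC hflip
  let T := 3 * r ^ r + 1
  obtain ⟨I, hI, hiso⟩ := Encoding.exists_interpretation hr S (Nat.lt_succ_self (3 * r ^ r))
  obtain ⟨P, time, hP⟩ := Encoding.exists_program T S
  refine ⟨I, hI, P, time, (.X * (.X + 6) + .C T) * .C r, fun n H _ => ?_⟩
  let e := Encoding.outIso T S H
  refine ⟨_, Encoding.outGraph T S H, ?_, by simp, hiso n H _ _ ⟨e⟩, hP n H⟩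
  let φ := Encoding.blockEquiv n T
  -- Numbering the representatives by `φ` turns them into grid coordinates without changing which of
  -- them agree.
  refine hS _ _ _ (Encoding.Block n T) (φ ∘ Encoding.first) (φ ∘ Encoding.last H) ?_
    ⟨e.symm.toEmbedding.trans (BlockGraph.embedding S id Function.injective_id ?_ ?_)⟩
  · intro b c h h'
    exact Encoding.eq_of_first_eq_of_last_eq (φ.injective h) (φ.injective h')
  · simp
  · simp
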